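/- **Setting.** Let $d\ge 1$, $m\ge 2$. In the fully dynamic model there are always $m$ supply units at locations in the unit cube $[0,1]^d$, initially at arbitrary locations. In each period $t=1,2,\dots$ a demand unit arrives at a uniformly random location, it is immediately matched to one of the $m$ supply units present, at a cost equal to the Euclidean distance between the two, the matched pair leaves, and then a new supply unit arrives at a uniformly random location. All arrival locations are independent. *Hierarchical Greedy* (HG) with height $\ell_0\ge 0$ and thresholds $(\gamma_\ell)_{\ell=0}^{\ell_0}$, where $0\le\gamma_{\ell_0}<m$ and $0\le\gamma_\ell\le 2^{-d}\gamma_{\ell+1}$ for $\ell<\ell_0$, is the following policy. For $0\le \ell\le\ell_0$ let $\mathcal H_\ell$ be the partition of the cube into $2^{(\ell_0-\ell)d}$ dyadic cubes of side $2^{-(\ell_0-\ell)}$. When a demand unit arrives, let $\mathcal S$ be the set of levels $\ell$ such that the cube of $\mathcal H_\ell$ containing the demand contains at most $\gamma_\ell$ supply units; let $\ell=0$ if $\mathcal S=\emptyset$ and $\ell=1+\max\mathcal S$ otherwise. Start from the cube of $\mathcal H_\ell$ that contains the demand, descend to a cube of $\mathcal H_0$ by moving each time to a child cube (one of the $2^d$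 dyadic subcubes at the next lower level) with the largest number of supply units, and match the demand to a supply unit in that cube of $\mathcal H_0$. Ties, and the choice of the unit in the last cube, are resolved by any measurable rule depending only on the current locations of the supply units and of the demand. For $K\ge0$, locations $x_1,\dots,x_m\in[0,1]^d$ are called *$K$-evenly spread* if for every axis-parallel cube $Q=\prod_k[a_k,a_k+s)$ with $\prod_k[a_k,a_k+s]\subseteq[0,1]^d$ we have $\bigl|\#\{i:x_i\in Q\}-ms^d\bigr|\le K\,(1+m^{1/d}s)^{d-1}$ (for $m=k^d$, $k\ge2$, the regular grid $\{0,\frac1{k-1},\dots,1\}^d$ is $K$-evenly spread with a $K$ that depends only on $d$). **Theorem (Achievability).** For every $d\ge1$ there are, for each $m\ge 2$, an admissible height and admissible thresholds (depending only on $d$ and $m$), and there is a constant $C_d<\infty$, such that for all $m\ge2$ there is an HG policy with these parameters that has a stationary distribution, and every HG policy with these parameters has expected average cost per match at most $$\frac{C_d}{m^{1/d}}\ \text{ if } d\ge2,\qquad \frac{C_1(\log m)^2}{m}\ \text{ if } d=1,$$ both in steady state (that is, under every stationary distribution) and, for arbitrary initial locations of the supply units, over every finite horizon of $N$ periods with $N\ge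 C_d\,m^{1.01+1/d}$ if $d\ge 2$, and $N\ge C_1m^3$ if $d=1$. Moreover, for every $K$ there is a constant $C_{d,K}<\infty$ such that, if the initial locations of the supply units are $K$-evenly spread, then the expected average cost per match of these policies is at most $C_{d,K}/m^{1/d}$ (if $d\ge2$), respectively $C_{1,K}(\log m)^2/m$ (if $d=1$), over every finite horizon $N\ge1$, for all $m\ge2$. -/

import Mathlib

open MeasureTheory

namespace SpatialMatching

noncomputable section

/-- The unit cube `[0,1]^d`. Its `volume` is the uniform probability distribution. -/
abbrev Cube (d : ℕ) : Type := Fin d → unitInterval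

/-- Euclidean distance on the unit cube. -/
def eDist {d : ℕ} (x y : Cube d) : ℝ :=
  dist (WithLp.toLp 2 (fun i => (x i : ℝ)) : EuclideanSpace ℝ (Fin d))
    (WithLp.toLp 2 (fun i => (y i : ℝ)))

/-- A state of the system: the locations of the `m` supply units. -/
abbrev Config (d m : ℕ) : Type := Fin m → Cube d

/-- A (stationary, deterministic) matching policy: given the locations of the `m` supply units
and the location of the demand unit that has just arrived, it chooses the supply unit to be
matched. -/
structure Policy (d m : ℕ) where
  /-- the supply unit matched to the demand unit -/
  choose : Config d m → Cube d → Fin m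
  measurable_choose : Measurable (fun p : Config d m × Cube d => choose p.1 p.2)

/-- The cost of a period that starts in state `x` and in which a demand unit arrives at `y`. -/
def matchCost {d m : ℕ} (π : Policy d m) (x : Config d m) (y : Cube d) : ℝ :=
  eDist y (x (π.choose x y))

/-- The state after a period that starts in state `x`, with a demand arrival at `y` followed by a
supply arrival at `s`: the matched supply unit leaves, and the new one takes its label. -/
def nextConfig {d m : ℕ} (π : Policy d m) (x : Config d m) (y s : Cube d) : Config d m :=
  Function.update x (π.choose x y) s

/-- An arrival sequence: in each period, the locations of the demand and of the supply arrival. -/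
abbrev Arrivals (d : ℕ) : Type := ℕ → Cube d × Cube d

/-- The law of the arrivals: all demand and supply locations are independent and uniform. -/
def arrivalLaw (d : ℕ) : Measure (Arrivals d) :=
  Measure.infinitePi (fun _ : ℕ => (volume : Measure (Cube d × Cube d)))

/-- The state at the beginning of period `t` (periods are numbered from `0`), when the initial
state is `x₀`. -/
def configAt {d m : ℕ} (π : Policy d m) (x₀ : Config d m) (ω : Arrivals d) : ℕ → Config d m
  | 0 => x₀
  | t + 1 => nextConfig π (configAt π x₀ ω t) (ω t).1 (ω t).2

/-- The expected average cost per match over the horizon `N`, from the initial state `x₀`. -/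
def avgCost {d m : ℕ} (π : Policy d m) (x₀ : Config d m) (N : ℕ) : ℝ :=
  ∫ ω, (∑ t ∈ Finset.range N, matchCost π (configAt π x₀ ω t) (ω t).1) / (N : ℝ) ∂(arrivalLaw d)

/-- `μ` is a stationary distribution (steady state) of the system under the policy `π`. -/
def IsStationary {d m : ℕ} (π : Policy d m) (μ : Measure (Config d m)) : Prop :=
  IsProbabilityMeasure μ ∧
    Measure.map (fun p : Config d m × (Cube d × Cube d) => nextConfig π p.1 p.2.1 p.2.2)
      (μ.prod volume) = μ

/-- The expected cost of a period whose initial state is distributed according to `μ`. -/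
def steadyCost {d m : ℕ} (π : Policy d m) (μ : Measure (Config d m)) : ℝ :=
  ∫ p : Config d m × Cube d, matchCost π p.1 p.2 ∂(μ.prod volume)

/-! ### The Hierarchical Greedy algorithm -/

/-- The level-`l` hypercube containing `x`, in the hierarchy of height `L`. The level-`l`
hypercubes have side length `2 ^ (-(L - l))`, and each is given by the integer vector of its
position in the grid; points on common boundaries go to the upper hypercube. -/
def hypercube {d : ℕ} (L l : ℕ) (x : Cube d) : Fin d → ℕ :=
  fun i => min ⌊(2 : ℝ) ^ (L - l) * (x i : ℝ)⌋₊ (2 ^ (L - l) - 1)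

/-- The number of supply units in the level-`l` hypercube `h`. -/
def supplyCount {d m : ℕ} (L l : ℕ) (x : Config d m) (h : Fin d → ℕ) : ℕ :=
  (Finset.univ.filter (fun i => hypercube L l (x i) = h)).card

/-- `c` is one of the `2 ^ d` children (one level down) of the hypercube `h`. -/
def IsChild {d : ℕ} (c h : Fin d → ℕ) : Prop := ∀ i, c i / 2 = h i

/-- The levels at which the hypercube containing the demand location `y` is undersupplied. -/
def undersupplied {d m : ℕ} (L : ℕ) (γ : ℕ → ℝ) (x : Config d m) (y : Cube d) : Finset ℕ :=
  (Finset.range (L + 1)).filter (fun l => (supplyCount L l x (hypercube L l y) : ℝ) ≤ γ l)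

/-- The level at which the demand is matched: `0` if no level is undersupplied, and one more than
the largest undersupplied level otherwise. -/
def matchLevel {d m : ℕ} (L : ℕ) (γ : ℕ → ℝ) (x : Config d m) (y : Cube d) : ℕ :=
  (undersupplied L γ x y).sup (fun l => l + 1)

/-- The requirements on the minimum supplies `γ 0, …, γ L`. -/
structure ValidThresholds (d m L : ℕ) (γ : ℕ → ℝ) : Prop where
  nonneg : ∀ l ≤ L, 0 ≤ γ l
  le_parent : ∀ l < L, γ l ≤ ((2 : ℝ) ^ d)⁻¹ * γ (l + 1)
  top_lt : γ L < m

/-- `π` is a Hierarchical Greedy policy with height `L` and minimum supplies `γ`: from the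
hypercube at the matching level that contains the demand, one descends to a leaf by moving to a
best-supplied child each time, and the demand is matched to a supply unit in that leaf. Ties, and
the choice of a supply unit within the leaf, are resolved arbitrarily. -/
def IsHierarchicalGreedy {d m : ℕ} (L : ℕ) (γ : ℕ → ℝ) (π : Policy d m) : Prop :=
  ∀ (x : Config d m) (y : Cube d), ∃ h : ℕ → (Fin d → ℕ),
    h (matchLevel L γ x y) = hypercube L (matchLevel L γ x y) y ∧
    (∀ l < matchLevel L γ x y, IsChild (h l) (h (l + 1)) ∧
      ∀ c, IsChild c (h (l + 1)) → supplyCount L l x c ≤ supplyCount L l x (h l)) ∧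
    hypercube L 0 (x (π.choose x y)) = h 0

/-- The `m` locations `x` are evenly spread, with constant `K`: the number of them in any
axis-parallel cube of side `s` inside `[0,1]^d` differs from `m * s ^ d` by at most
`K * (1 + m ^ (1/d) * s) ^ (d - 1)`, the order of the number of points of a regular grid of `m`
points that are near the boundary of such a cube. -/
def EvenlySpread {d m : ℕ} (K : ℝ) (x : Config d m) : Prop :=
  ∀ (a : Fin d → ℝ) (s : ℝ), 0 ≤ s → (∀ k, 0 ≤ a k ∧ a k + s ≤ 1) →
    |((Finset.univ.filter (fun i => ∀ k, a k ≤ (x i k : ℝ) ∧ (x i k : ℝ) < a k + s)).card : ℝ)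
        - m * s ^ d| ≤ K * (1 + (m : ℝ) ^ (1 / (d : ℝ)) * s) ^ (d - 1)

/-- In dimension `d`, Hierarchical Greedy with heights `L m` and minimum supplies `γ m` (for `m`
supply units) achieves an expected average cost per match of order `rate m`: in steady state and
over all horizons of at least order `horizon m` for arbitrary initial locations, and over all
horizons for evenly spread initial locations. -/
def HGAchieves (d : ℕ) (L : ℕ → ℕ) (γ : ℕ → ℕ → ℝ) (rate horizon : ℕ → ℝ) : Prop :=
  (∀ m ≥ 2, ValidThresholds d m (L m) (γ m) ∧
    ∃ π : Policy d m, IsHierarchicalGreedy (L m) (γ m) π ∧ ∃ μ, IsStationary π μ) ∧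
  (∃ C : ℝ, 0 < C ∧ ∀ m ≥ 2, ∀ π : Policy d m, IsHierarchicalGreedy (L m) (γ m) π →
    (∀ μ, IsStationary π μ → steadyCost π μ ≤ C * rate m) ∧
    (∀ (x : Config d m) (N : ℕ), C * horizon m ≤ N → avgCost π x N ≤ C * rate m)) ∧
  (∀ K : ℝ, ∃ C : ℝ, 0 < C ∧ ∀ m ≥ 2, ∀ π : Policy d m, IsHierarchicalGreedy (L m) (γ m) π →
    ∀ x : Config d m, EvenlySpread K x → ∀ N ≥ 1, avgCost π x N ≤ C * rate m)

end

end SpatialMatching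

/-!
# Hierarchical Greedy matches at a cost of order `m ^ (-1 / d)`

A demand unit that is matched at level `k` costs at most the diameter of a level-`k` hypercube, so
the cost of a period is at most `√d * 2 ^ (-L) * (1 + ∑ l < L, 2 ^ (l + 1) * P (match level = l + 1))`
(`IsHierarchicalGreedy.steadyCost_le`), and matches at level `l + 1` have to be rare. They are
counted by a Lyapunov function. Write `N_h` for the number of supply units in `h`, and let
`Δ = γ (l + 1) / 2 ^ d - γ l` and `a = Δ / 2`. The *deficit* of a level-`l` hypercube `c` with parent
`H` is `N_H / 2 ^ d - N_c`, and the potential is the sum of a Huber function of the deficits, which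
is zero up to `a`, has second derivative `1 / a` up to `2 * a`, and slope one after that.

Supply arrivals, and demand units that are matched inside their own level-`l` hypercube, hit the
children of each `H` equally often, so their first-order effects on the potential vanish on average,
and the second-order effect of each of the two arrivals is at most `1 / (2 * a)`. A demand unit that is matched above level `l`
takes a unit from a best-supplied child, where the slope is zero, so this never hurts. If it is
matched exactly at level `l + 1`, then its own level-`l` hypercube has a deficit of at least
`Δ = 2 * a`, where the slope is one, and the potential gains `1` against the balanced flow. Hence the
drift of the potential is at most `1 / a - P (match level = l + 1)`
(`IsHierarchicalGreedy.integral_stepLaw_le`). This has three consequences.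

* In steady state the drift is zero, and the probability is at most `2 / Δ`.
* From any initial state the potential is at most `m`, since the Huber function is at most linear.
  So there are at most `m + 2 * N / Δ` expected matches at level `l + 1` in `N` periods, and the
  transient terms add up to order `2 ^ L * m ≤ m ^ (1 + 1 / d)`.
* From an evenly spread state the potential starts at zero, except at hypercubes next to
  accumulations of units on the upper faces of the unit cube, which half-open cubes do not see.
  These are too few to matter
  (`IsHierarchicalGreedy.sum_matchLevel_prob_le_of_evenlySpread`).

It remains to choose thresholds for which `∑ l, 2 ^ l / Δ` is bounded for `d ≥ 2`, and of order
`(log m) ^ 2` for `d = 1`; `γ l` is `2 ^ (l * d)` times a partial sum of increments `δ`, which makes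
`Δ = 2 ^ (l * d) * δ l`.

A stationary distribution exists for a policy that only looks at the leaves containing the units:
these form a finite Markov chain, and given the leaves the units may be taken independent and
uniform (`exists_stationary_of_cells`).
-/

namespace SpatialMatching

noncomputable section

variable {d m L l : ℕ}

/-! ### The dyadic hierarchy -/

/-- The hypercube of the next higher level that contains `h`. -/
def parent {d : ℕ} (h : Fin d → ℕ) : Fin d → ℕ := fun i => h i / 2

/-- The `2 ^ d` hypercubes of the next lower level that make up `H`. -/
def children {d : ℕ} (H : Fin d → ℕ) : Finset (Fin d → ℕ) :=
  Fintype.piFinset fun i => {2 * H i, 2 * H i + 1}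

/-- The hypercubes of level `l` in the hierarchy of height `L`. -/
def grid (d L l : ℕ) : Finset (Fin d → ℕ) :=
  Fintype.piFinset fun _ => Finset.range (2 ^ (L - l))


lemma mem_children {c H : Fin d → ℕ} : c ∈ children H ↔ parent c = H := by
  simp only [children, Fintype.mem_piFinset, Finset.mem_insert, Finset.mem_singleton, parent,
    funext_iff]
  refine forall_congr' fun i => ?_
  omega

lemma isChild_iff {c H : Fin d → ℕ} : IsChild c H ↔ c ∈ children H := by
  rw [mem_children, funext_iff]; rfl

lemma card_children (H : Fin d → ℕ) : (children H).card = 2 ^ d := by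
  simp [children, Fintype.card_piFinset]

lemma mem_grid {h : Fin d → ℕ} : h ∈ grid d L l ↔ ∀ i, h i < 2 ^ (L - l) := by
  simp [grid]

lemma hypercube_mem_grid (x : Cube d) : hypercube L l x ∈ grid d L l := by
  rw [mem_grid]
  intro i
  have : 0 < 2 ^ (L - l) := by positivity
  simp only [hypercube]
  omega

lemma parent_mem_grid (hl : l < L) {c : Fin d → ℕ} :
    parent c ∈ grid d L (l + 1) ↔ c ∈ grid d L l := by
  simp only [mem_grid, parent]
  refine forall_congr' fun i => ?_
  have h : 2 ^ (L - l) = 2 * 2 ^ (L - (l + 1)) := by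
    rw [← pow_succ']; congr 1; omega
  rw [h]; omega

lemma parent_hypercube (hl : l < L) (x : Cube d) :
    parent (hypercube L l x) = hypercube L (l + 1) x := by
  funext i
  have h : L - l = (L - (l + 1)) + 1 := by omega
  have hfl : ⌊(2 : ℝ) ^ (L - l) * (x i : ℝ)⌋₊ / 2 = ⌊(2 : ℝ) ^ (L - (l + 1)) * (x i : ℝ)⌋₊ := by
    have := Nat.floor_div_natCast ((2 : ℝ) ^ (L - l) * (x i : ℝ)) 2
    rw [← this, h, pow_succ]
    congr 1
    push_cast
    ring
  have h2 : 2 ^ (L - l) = 2 * 2 ^ (L - (l + 1)) := by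
    rw [h, pow_succ']
  have : 0 < 2 ^ (L - (l + 1)) := by positivity
  simp only [parent, hypercube, ← hfl, h2]
  omega

/-- The hypercube of a level that contains a point determines those of the higher levels. -/
lemma hypercube_congr {k : ℕ} (hlk : l ≤ k) (hk : k ≤ L) {x y : Cube d}
    (h : hypercube L l x = hypercube L l y) : hypercube L k x = hypercube L k y := by
  induction k, hlk using Nat.le_induction with
  | base => exact h
  | succ k hk' ih =>
    rw [← parent_hypercube (by omega) x, ← parent_hypercube (by omega) y, ih (by omega)]

lemma hypercube_top (x : Cube d) : hypercube L L x = 0 := by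
  funext i; simp [hypercube]

lemma measurable_hypercube : Measurable (hypercube (d := d) L l) := by
  refine measurable_pi_lambda _ fun i => ?_
  refine Measurable.min ?_ measurable_const
  refine Nat.measurable_floor.comp ?_
  exact (measurable_subtype_coe.comp (measurable_pi_apply i)).const_mul _

lemma sum_grid_eq_sum_children (hl : l < L) (F : (Fin d → ℕ) → ℝ) :
    ∑ h ∈ grid d L l, F h = ∑ H ∈ grid d L (l + 1), ∑ c ∈ children H, F c := by
  rw [← Finset.sum_fiberwise_of_maps_to (g := parent) (t := grid d L (l + 1))
    (fun c hc => (parent_mem_grid hl).2 hc)]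
  refine Finset.sum_congr rfl fun H hH => Finset.sum_congr ?_ fun _ _ => rfl
  ext c
  simp only [Finset.mem_filter, mem_children]
  constructor
  · exact fun h => h.2
  · rintro rfl
    exact ⟨(parent_mem_grid hl).1 hH, rfl⟩

lemma supplyCount_eq_sum (x : Config d m) (h : Fin d → ℕ) :
    (supplyCount L l x h : ℝ) = ∑ i, if hypercube L l (x i) = h then (1 : ℝ) else 0 := by
  simp [supplyCount]

lemma supplyCount_succ (hl : l < L) (x : Config d m) (H : Fin d → ℕ) :
    (supplyCount L (l + 1) x H : ℝ) = ∑ c ∈ children H, (supplyCount L l x c : ℝ) := by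
  simp only [supplyCount_eq_sum]
  rw [Finset.sum_comm]
  refine Finset.sum_congr rfl fun i _ => ?_
  simp only [Finset.sum_ite_eq, mem_children, parent_hypercube hl]

lemma sum_supplyCount (x : Config d m) :
    ∑ h ∈ grid d L l, (supplyCount L l x h : ℝ) = m := by
  simp only [supplyCount_eq_sum]
  rw [Finset.sum_comm]
  simp [Finset.sum_ite_eq, hypercube_mem_grid]

lemma supplyCount_top (x : Config d m) (y : Cube d) :
    supplyCount L L x (hypercube L L y) = m := by
  simp [supplyCount, hypercube_top]

/-- In a period, the matched unit disappears from its hypercube and the new one is added. -/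
lemma supplyCount_update (x : Config d m) (j : Fin m) (s : Cube d) :
    (fun h => (supplyCount L l (Function.update x j s) h : ℝ)) =
      (fun h => (supplyCount L l x h : ℝ)) + Pi.single (hypercube L l (x j)) (-1)
        + Pi.single (hypercube L l s) 1 := by
  classical
  funext h
  simp only [supplyCount_eq_sum, Pi.add_apply]
  rw [← Finset.add_sum_erase _ _ (Finset.mem_univ j), ← Finset.add_sum_erase (a := j) _
    (fun i => if hypercube L l (x i) = h then (1 : ℝ) else 0) (Finset.mem_univ j)]
  have : ∑ i ∈ Finset.univ.erase j, (if hypercube L l (Function.update x j s i) = h then (1 : ℝ)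
      else 0) = ∑ i ∈ Finset.univ.erase j, (if hypercube L l (x i) = h then (1 : ℝ) else 0) := by
    refine Finset.sum_congr rfl fun i hi => ?_
    rw [Function.update_of_ne (Finset.ne_of_mem_erase hi)]
  rw [this, Function.update_self]
  simp only [Pi.single_apply, eq_comm (a := h)]
  split_ifs <;> ring

/-! ### The uniform distribution on the hierarchy -/

lemma min_floor_eq_iff {k n : ℕ} (hn : n < 2 ^ k) {t : unitInterval} (ht : (t : ℝ) < 1) :
    min ⌊(2 : ℝ) ^ k * (t : ℝ)⌋₊ (2 ^ k - 1) = n ↔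
      (t : ℝ) ∈ Set.Ico ((n : ℝ) / 2 ^ k) ((n + 1) / 2 ^ k) := by
  have h2 : (0 : ℝ) < 2 ^ k := by positivity
  have h0 : 0 ≤ (2 : ℝ) ^ k * (t : ℝ) := mul_nonneg h2.le t.2.1
  have hlt : ⌊(2 : ℝ) ^ k * (t : ℝ)⌋₊ < 2 ^ k := by
    rw [Nat.floor_lt h0]; push_cast; nlinarith
  rw [min_eq_left (by omega), Nat.floor_eq_iff h0, Set.mem_Ico, div_le_iff₀ h2, lt_div_iff₀ h2,
    mul_comm (2 ^ k : ℝ)]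

lemma volume_floor_eq {k n : ℕ} (hn : n < 2 ^ k) :
    volume {t : unitInterval | min ⌊(2 : ℝ) ^ k * (t : ℝ)⌋₊ (2 ^ k - 1) = n} =
      ENNReal.ofReal ((2 ^ k)⁻¹) := by
  have h2 : (0 : ℝ) < 2 ^ k := by positivity
  have hn1 : ((n : ℝ) + 1) ≤ 2 ^ k := by exact_mod_cast hn
  have hae : {t : unitInterval | min ⌊(2 : ℝ) ^ k * (t : ℝ)⌋₊ (2 ^ k - 1) = n} =ᵐ[volume]
      (Subtype.val ⁻¹' Set.Ico ((n : ℝ) / 2 ^ k) ((n + 1) / 2 ^ k) : Set unitInterval) := by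
    have h1 : ∀ᵐ t : unitInterval, t ≠ 1 := by
      simp [ae_iff]
    filter_upwards [h1] with t ht
    have ht' : (t : ℝ) < 1 := lt_of_le_of_ne t.2.2 fun h => ht (Subtype.ext h)
    exact propext (min_floor_eq_iff hn ht')
  rw [measure_congr hae, unitInterval.volume_apply, Subtype.image_preimage_coe,
    Set.inter_eq_right.2, Real.volume_Ico]
  · congr 1; field_simp; ring
  · intro t ht
    refine ⟨le_trans (by positivity) ht.1, ht.2.le.trans ?_⟩
    rw [div_le_one h2]; exact hn1

lemma volume_hypercube_eq {h : Fin d → ℕ} (hh : h ∈ grid d L l) :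
    volume {y : Cube d | hypercube L l y = h} = ENNReal.ofReal ((2 ^ ((L - l) * d))⁻¹) := by
  have : {y : Cube d | hypercube L l y = h} = Set.univ.pi fun i =>
      {t : unitInterval | min ⌊(2 : ℝ) ^ (L - l) * (t : ℝ)⌋₊ (2 ^ (L - l) - 1) = h i} := by
    ext y; simp [hypercube, funext_iff]
  rw [this, volume_pi_pi, Finset.prod_congr rfl fun i _ => volume_floor_eq (mem_grid.1 hh i)]
  rw [Finset.prod_const, Finset.card_univ, Fintype.card_fin, ← ENNReal.ofReal_pow (by positivity),
    inv_pow, ← pow_mul]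

/-- A uniform point is equally likely to be in each of the hypercubes of a level. -/
lemma integral_comp_hypercube (F : (Fin d → ℕ) → ℝ) :
    ∫ y : Cube d, F (hypercube L l y) = (2 ^ ((L - l) * d))⁻¹ * ∑ h ∈ grid d L l, F h := by
  have h1 : ∀ y : Cube d, F (hypercube L l y) =
      ∑ h ∈ grid d L l, Set.indicator {y | hypercube L l y = h} (fun _ => F h) y := by
    intro y
    simp only [Set.indicator_apply, Set.mem_ofPred_eq]
    rw [Finset.sum_ite_eq, if_pos (hypercube_mem_grid y)]
  have hm : ∀ h, MeasurableSet {y : Cube d | hypercube L l y = h} := fun h =>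
    measurable_hypercube (measurableSet_singleton h)
  simp_rw [h1]
  rw [integral_finsetSum _ fun h _ => (integrable_const _).indicator (hm h), Finset.mul_sum]
  refine Finset.sum_congr rfl fun h hh => ?_
  rw [integral_indicator_const _ (hm h), smul_eq_mul, measureReal_def, volume_hypercube_eq hh,
    ENNReal.toReal_ofReal (by positivity)]

/-- The average of `F` over the children of `H`. -/
def childAvg (F : (Fin d → ℕ) → ℝ) (H : Fin d → ℕ) : ℝ := (∑ c ∈ children H, F c) / 2 ^ d

/-- Inside each hypercube of level `l + 1`, the children are equally likely. -/
lemma integral_sub_childAvg (hl : l < L) (W F : (Fin d → ℕ) → ℝ) :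
    ∫ y : Cube d, W (hypercube L (l + 1) y) *
      (F (hypercube L l y) - childAvg F (hypercube L (l + 1) y)) = 0 := by
  simp_rw [← parent_hypercube hl]
  rw [integral_comp_hypercube (fun h => W (parent h) * (F h - childAvg F (parent h))),
    sum_grid_eq_sum_children hl]
  refine mul_eq_zero_of_right _ (Finset.sum_eq_zero fun H _ => ?_)
  have : ∀ c ∈ children H, W (parent c) * (F c - childAvg F (parent c)) =
      W H * (F c - childAvg F H) := fun c hc => by rw [mem_children.1 hc]
  rw [Finset.sum_congr rfl this, ← Finset.mul_sum, Finset.sum_sub_distrib, Finset.sum_const,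
    card_children, childAvg]
  simp
  right
  field_simp
  simp

/-! ### The Huber potential -/

/-- The derivative of `huber a`: it increases linearly from `0` at `a` to `1` at `2 * a`. -/
def slope (a u : ℝ) : ℝ := max 0 (min 1 ((u - a) / a))

/-- The one-sided Huber function: it vanishes up to `a`, is quadratic with second derivative `1 / a`
between `a` and `2 * a`, and has slope `1` from there on. -/
def huber (a u : ℝ) : ℝ := slope a u * (u - a) - a * slope a u ^ 2 / 2

section Huber
variable {a u : ℝ}

lemma slope_nonneg : 0 ≤ slope a u := le_max_left _ _

lemma slope_le_one : slope a u ≤ 1 := max_le zero_le_one (min_le_left _ _)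

lemma slope_eq_zero (ha : 0 < a) (h : u ≤ a) : slope a u = 0 :=
  max_eq_left ((min_le_right _ _).trans (div_nonpos_of_nonpos_of_nonneg (by linarith) ha.le))

lemma slope_eq_one (ha : 0 < a) (h : 2 * a ≤ u) : slope a u = 1 := by
  have : 1 ≤ (u - a) / a := by rw [le_div_iff₀ ha]; linarith
  rw [slope, min_eq_left this, max_eq_right zero_le_one]

/-- `slope a u` is the projection of `(u - a) / a` to `[0, 1]`. -/
lemma sub_slope_mul_nonpos (ha : 0 < a) {θ : ℝ} (h0 : 0 ≤ θ) (h1 : θ ≤ 1) :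
    (θ - slope a u) * (u - a - a * slope a u) ≤ 0 := by
  have hu : u - a = a * ((u - a) / a) := by field_simp
  rw [hu, ← mul_sub]
  unfold slope
  generalize (u - a) / a = v
  have key : (θ - max 0 (min 1 v)) * (v - max 0 (min 1 v)) ≤ 0 := by
    rcases le_total v 0 with hv | hv
    · rw [min_eq_right (by linarith), max_eq_left hv]; nlinarith
    rcases le_total v 1 with hv' | hv'
    · rw [min_eq_right hv', max_eq_right hv]; simp
    · rw [min_eq_left hv', max_eq_right zero_le_one]; nlinarith
  calc _ = a * ((θ - max 0 (min 1 v)) * (v - max 0 (min 1 v))) := by ring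
    _ ≤ 0 := mul_nonpos_of_nonneg_of_nonpos ha.le key

/-- The quadratic upper bound of a convex function whose derivative is `1 / a`-Lipschitz. -/
lemma huber_add_le (ha : 0 < a) (u ε : ℝ) :
    huber a (u + ε) ≤ huber a u + slope a u * ε + ε ^ 2 / (2 * a) := by
  have h := sub_slope_mul_nonpos (u := u) ha (slope_nonneg (a := a) (u := u + ε)) slope_le_one
  unfold huber
  generalize slope a (u + ε) = θ' at *
  generalize slope a u = θ at *
  have h2 : 0 ≤ (ε - a * (θ' - θ)) ^ 2 / (2 * a) := by positivity
  have h3 : (ε - a * (θ' - θ)) ^ 2 / (2 * a) =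
      ε ^ 2 / (2 * a) - (θ' - θ) * ε + a * (θ' - θ) ^ 2 / 2 := by
    field_simp; ring
  rw [h3] at h2
  nlinarith

lemma huber_nonneg (ha : 0 < a) : 0 ≤ huber a u := by
  have h := sub_slope_mul_nonpos (u := u) ha le_rfl zero_le_one
  unfold huber
  have : 0 ≤ a * slope a u ^ 2 := by positivity
  nlinarith

lemma huber_eq_zero (ha : 0 < a) (h : u ≤ a) : huber a u = 0 := by
  simp [huber, slope_eq_zero ha h]

lemma huber_le (ha : 0 < a) {v : ℝ} (hv : 0 ≤ v) (huv : u ≤ v) : huber a u ≤ v := by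
  unfold huber
  have h0 := slope_nonneg (a := a) (u := u)
  have h1 := slope_le_one (a := a) (u := u)
  have : 0 ≤ a * slope a u ^ 2 := by positivity
  nlinarith

end Huber

/-- How much the number of units in the hypercube `c` falls short of the average over the children
of its parent, when `n` gives the numbers of units in the hypercubes of a level. -/
def deficit (n : (Fin d → ℕ) → ℝ) (c : Fin d → ℕ) : ℝ := childAvg n (parent c) - n c

/-- The imbalance among the children of the hypercubes in `G`. -/
def potential (a : ℝ) (G : Finset (Fin d → ℕ)) (n : (Fin d → ℕ) → ℝ) : ℝ :=
  ∑ H ∈ G, ∑ c ∈ children H, huber a (deficit n c)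

/-- The mean slope at the children of `H`, minus the slope at the child `c`: the first-order change
of the potential if a unit is added to `c`. -/
def gradient (a : ℝ) (n : (Fin d → ℕ) → ℝ) (c : Fin d → ℕ) : ℝ :=
  childAvg (fun c' => slope a (deficit n c')) (parent c) - slope a (deficit n c)

lemma potential_nonneg {a : ℝ} (ha : 0 < a) (G : Finset (Fin d → ℕ)) (n : (Fin d → ℕ) → ℝ) :
    0 ≤ potential a G n :=
  Finset.sum_nonneg fun _ _ => Finset.sum_nonneg fun _ _ => huber_nonneg ha

lemma childAvg_nonneg {F : (Fin d → ℕ) → ℝ} (hF : ∀ c, 0 ≤ F c) (H : Fin d → ℕ) :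
    0 ≤ childAvg F H :=
  div_nonneg (Finset.sum_nonneg fun _ _ => hF _) (by positivity)

lemma childAvg_add (F F' : (Fin d → ℕ) → ℝ) (H : Fin d → ℕ) :
    childAvg (F + F') H = childAvg F H + childAvg F' H := by
  simp [childAvg, Finset.sum_add_distrib, add_div]

lemma childAvg_single (c : Fin d → ℕ) (ε : ℝ) (H : Fin d → ℕ) :
    childAvg (Pi.single c ε) H = if parent c = H then ε / 2 ^ d else 0 := by
  unfold childAvg
  simp only [Pi.single_apply, Finset.sum_ite_eq', mem_children]
  split_ifs <;> simp

/-- Second-order expansion of the potential under the addition (`ε = 1`) or removal (`ε = -1`) of a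
unit at `c`. -/
lemma potential_add_single {a : ℝ} (ha : 0 < a) (G : Finset (Fin d → ℕ)) (n : (Fin d → ℕ) → ℝ)
    (c : Fin d → ℕ) {ε : ℝ} (hε : ε ^ 2 = 1) :
    potential a G (n + Pi.single c ε) ≤
      potential a G n + (if parent c ∈ G then ε * gradient a n c else 0) + 1 / (2 * a) := by
  classical
  have hdef : ∀ c', deficit (n + Pi.single c ε) c' = deficit n c' +
      ((if parent c = parent c' then ε / 2 ^ d else 0) - if c' = c then ε else 0) := by
    intro c'
    simp only [deficit, childAvg_add, childAvg_single, Pi.add_apply, Pi.single_apply]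
    ring
  have hne : ∀ H, H ≠ parent c → ∑ c' ∈ children H, huber a (deficit (n + Pi.single c ε) c') =
      ∑ c' ∈ children H, huber a (deficit n c') := by
    intro H hH
    refine Finset.sum_congr rfl fun c' hc' => ?_
    rw [mem_children] at hc'
    have h1 : parent c ≠ parent c' := by rw [hc']; exact hH.symm
    have h2 : c' ≠ c := fun h => h1 (by rw [h])
    simp [hdef, h1, h2]
  have hpos : 0 ≤ 1 / (2 * a) := by positivity
  unfold potential
  split_ifs with hG
  · rw [← Finset.add_sum_erase _ _ hG, ← Finset.add_sum_erase _ (fun H => ∑ c ∈ children H, _) hG,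
      Finset.sum_congr rfl fun H hH => hne H (Finset.ne_of_mem_erase hH)]
    suffices ∑ c' ∈ children (parent c), huber a (deficit (n + Pi.single c ε) c') ≤
        ∑ c' ∈ children (parent c), huber a (deficit n c') + ε * gradient a n c + 1 / (2 * a) by
      linarith
    have hc : c ∈ children (parent c) := mem_children.2 rfl
    set D : ℝ := 2 ^ d with hD
    have hDpos : 0 < D := by positivity
    have hD1 : 1 ≤ D := one_le_pow₀ (by norm_num)
    -- The squares of the changes of the deficits in the family of `c` add up to `1 - 1 / D ≤ 1`.
    have hterm : ∀ c' ∈ children (parent c), huber a (deficit (n + Pi.single c ε) c') ≤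
        huber a (deficit n c') + (slope a (deficit n c') * (ε / D)
          - if c' = c then slope a (deficit n c') * ε else 0)
          + (1 / D ^ 2 + if c' = c then 1 - 2 / D else 0) / (2 * a) := by
      intro c' hc'
      rw [hdef, if_pos (mem_children.1 hc').symm]
      refine (huber_add_le ha _ _).trans (le_of_eq ?_)
      have : (ε / D - if c' = c then ε else 0) ^ 2 =
          1 / D ^ 2 + if c' = c then 1 - 2 / D else 0 := by
        split_ifs
        · calc _ = ε ^ 2 * (1 / D - 1) ^ 2 := by ring
            _ = _ := by rw [hε]; ring
        · calc _ = ε ^ 2 * (1 / D) ^ 2 := by ring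
            _ = _ := by rw [hε]; ring
      rw [this]
      split_ifs <;> ring
    refine (Finset.sum_le_sum hterm).trans ?_
    rw [Finset.sum_add_distrib, Finset.sum_add_distrib, Finset.sum_sub_distrib, ← Finset.sum_mul,
      Finset.sum_ite_eq' , if_pos hc, ← Finset.sum_div, Finset.sum_add_distrib, Finset.sum_ite_eq',
      if_pos hc, Finset.sum_const, card_children, nsmul_eq_mul]
    push_cast
    rw [← hD, gradient, childAvg, ← hD]
    have h3 : (D * (1 / D ^ 2) + (1 - 2 / D)) / (2 * a) ≤ 1 / (2 * a) := by
      refine div_le_div_of_nonneg_right ?_ (by positivity)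
      have : D * (1 / D ^ 2) = 1 / D := by field_simp
      rw [this]
      have : 2 / D = 2 * (1 / D) := by ring
      have : 0 ≤ 1 / D := by positivity
      linarith
    have h4 : (∑ c' ∈ children (parent c), slope a (deficit n c')) * (ε / D) =
      ε * ((∑ c' ∈ children (parent c), slope a (deficit n c')) / D) := by ring
    linarith
  · rw [Finset.sum_congr rfl fun H hH => hne H fun h => hG (h ▸ hH)]
    linarith

/-- The potential never exceeds the number of units, whatever the threshold `a` is. -/
lemma potential_le {a : ℝ} (ha : 0 < a) (hl : l < L) {G : Finset (Fin d → ℕ)}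
    (hG : G ⊆ grid d L (l + 1)) (x : Config d m) :
    potential a G (fun h => (supplyCount L l x h : ℝ)) ≤ m := by
  have h0 : ∀ c : Fin d → ℕ, (0 : ℝ) ≤ supplyCount L l x c := fun _ => Nat.cast_nonneg _
  calc potential a G (fun h => (supplyCount L l x h : ℝ))
      ≤ ∑ H ∈ G, ∑ c ∈ children H, childAvg (fun h => (supplyCount L l x h : ℝ)) H := by
        refine Finset.sum_le_sum fun H _ => Finset.sum_le_sum fun c hc => ?_
        refine huber_le ha (childAvg_nonneg h0 H) ?_
        rw [deficit, mem_children.1 hc]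
        linarith [h0 c]
    _ = ∑ H ∈ G, (supplyCount L (l + 1) x H : ℝ) := by
        refine Finset.sum_congr rfl fun H _ => ?_
        rw [Finset.sum_const, card_children, childAvg, supplyCount_succ hl, nsmul_eq_mul]
        push_cast
        field_simp
    _ ≤ ∑ H ∈ grid d L (l + 1), (supplyCount L (l + 1) x H : ℝ) :=
        Finset.sum_le_sum_of_subset_of_nonneg hG fun _ _ _ => Nat.cast_nonneg _
    _ = m := sum_supplyCount x

/-- A uniform arrival has no first-order effect on the potential, even if restricted to a union of
parents. -/
lemma integral_gradient (hl : l < L) (a : ℝ) (W : (Fin d → ℕ) → ℝ) (n : (Fin d → ℕ) → ℝ) :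
    ∫ y : Cube d, W (hypercube L (l + 1) y) * gradient a n (hypercube L l y) = 0 := by
  have h := integral_sub_childAvg hl W (fun c => slope a (deficit n c))
  rw [← neg_eq_zero, ← integral_neg, ← h]
  congr 1 with y
  rw [gradient, parent_hypercube hl]
  ring

/-! ### Measurability -/

/-- A function that only depends on a measurable label in a discrete space is measurable. -/
lemma measurable_of_factorsThrough {α β γ : Type*} [MeasurableSpace α] [MeasurableSpace β]
    [DiscreteMeasurableSpace β] [MeasurableSpace γ] [Nonempty γ] {f : α → β} (hf : Measurable f)
    {g : α → γ} (hg : g.FactorsThrough f) : Measurable g := by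
  have : g = Function.extend f g (fun _ => Classical.arbitrary γ) ∘ f := by
    funext x; simp [hg.extend_apply]
  rw [this]
  exact (Measurable.of_discrete).comp hf

/-- The hypercubes of level `l` that contain the supply units. -/
def cells (L l : ℕ) (x : Config d m) : Fin m → Fin d → ℕ := fun i => hypercube L l (x i)

lemma measurable_cells : Measurable (cells (d := d) (m := m) L l) :=
  measurable_pi_lambda _ fun i => measurable_hypercube.comp (measurable_pi_apply i)

lemma supplyCount_congr {x x' : Config d m} (h : cells L l x = cells L l x') :
    supplyCount L l x = supplyCount L l x' := by
  funext H
  have : ∀ i, hypercube L l (x i) = hypercube L l (x' i) := fun i => congrFun h i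
  simp [supplyCount, this]

lemma cells_congr (hl : l ≤ L) {x x' : Config d m} (h : cells L 0 x = cells L 0 x') :
    cells L l x = cells L l x' := by
  funext i
  exact hypercube_congr (Nat.zero_le _) hl (congrFun h i)

lemma matchLevel_congr {γ : ℕ → ℝ} {x x' : Config d m} {y y' : Cube d}
    (hx : cells L 0 x = cells L 0 x') (hy : hypercube L 0 y = hypercube L 0 y') :
    matchLevel L γ x y = matchLevel L γ x' y' := by
  unfold matchLevel undersupplied
  congr 1
  refine Finset.filter_congr fun k hk => ?_
  have hk : k ≤ L := by simpa [Nat.lt_succ_iff] using hk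
  rw [supplyCount_congr (cells_congr hk hx), hypercube_congr (Nat.zero_le _) hk hy]

lemma measurable_cells_prod :
    Measurable fun p : Config d m × Cube d => (cells L l p.1, hypercube L l p.2) :=
  (measurable_cells.comp measurable_fst).prodMk (measurable_hypercube.comp measurable_snd)

lemma measurable_matchLevel (γ : ℕ → ℝ) :
    Measurable fun p : Config d m × Cube d => matchLevel L γ p.1 p.2 :=
  measurable_of_factorsThrough (measurable_cells_prod (L := L) (l := 0)) fun p q h => by
    simp only [Prod.mk.injEq] at h
    exact matchLevel_congr h.1 h.2

/-- The potential of a configuration, with respect to the hypercubes of level `l`. -/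
def configPotential (L l : ℕ) (a : ℝ) (G : Finset (Fin d → ℕ)) (x : Config d m) : ℝ :=
  potential a G fun h => (supplyCount L l x h : ℝ)

lemma measurable_configPotential (a : ℝ) (G : Finset (Fin d → ℕ)) :
    Measurable (configPotential (m := m) L l a G) :=
  measurable_of_factorsThrough (measurable_cells (L := L) (l := l)) fun x x' h => by
    simp only [configPotential, supplyCount_congr h]

lemma measurable_nextConfig (π : Policy d m) :
    Measurable fun p : Config d m × (Cube d × Cube d) => nextConfig π p.1 p.2.1 p.2.2 := by
  refine measurable_pi_lambda _ fun i => ?_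
  have hc : Measurable fun p : Config d m × (Cube d × Cube d) => π.choose p.1 p.2.1 :=
    π.measurable_choose.comp (measurable_fst.prodMk (measurable_fst.comp measurable_snd))
  simp only [nextConfig, Function.update_apply]
  refine Measurable.ite ?_ (measurable_snd.comp measurable_snd)
    ((measurable_pi_apply i).comp measurable_fst)
  have : {p : Config d m × (Cube d × Cube d) | i = π.choose p.1 p.2.1} =
      (fun p : Config d m × (Cube d × Cube d) => π.choose p.1 p.2.1) ⁻¹' {i} := by
    ext p; simp [eq_comm]
  rw [this]
  exact hc (measurableSet_singleton i)

lemma integrable_comp_hypercube (F : (Fin d → ℕ) → ℝ) :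
    Integrable fun y : Cube d => F (hypercube L l y) := by
  have hm : Measurable fun y : Cube d => F (hypercube L l y) :=
    Measurable.of_discrete.comp measurable_hypercube
  refine Integrable.of_bound hm.aestronglyMeasurable (∑ h ∈ grid d L l, ‖F h‖)
    (ae_of_all _ fun y => ?_)
  exact Finset.single_le_sum (f := fun h => ‖F h‖) (fun _ _ => norm_nonneg _)
    (hypercube_mem_grid y)

lemma integrable_gradient (hl : l < L) (a : ℝ) (W n : (Fin d → ℕ) → ℝ) :
    Integrable fun y : Cube d =>
      W (hypercube L (l + 1) y) * gradient a n (hypercube L l y) := by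
  have h := integrable_comp_hypercube (L := L) (l := l) fun h => W (parent h) * gradient a n h
  simpa only [parent_hypercube hl] using h

/-! ### The matches of Hierarchical Greedy -/

section HG
variable {γ : ℕ → ℝ} {x : Config d m} {y : Cube d}

lemma matchLevel_le (htop : γ L < m) : matchLevel L γ x y ≤ L := by
  refine Finset.sup_le fun k hk => ?_
  simp only [undersupplied, Finset.mem_filter, Finset.mem_range] at hk
  by_contra hne
  have : k = L := by omega
  subst this
  rw [supplyCount_top] at hk
  linarith [hk.2]

lemma lt_supplyCount {k : ℕ} (hk : k ≤ L) (h : matchLevel L γ x y ≤ k) :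
    γ k < supplyCount L k x (hypercube L k y) := by
  by_contra hlt
  have hmem : k ∈ undersupplied L γ x y := by
    simp only [undersupplied, Finset.mem_filter, Finset.mem_range]
    exact ⟨by omega, not_lt.1 hlt⟩
  have := Finset.le_sup (f := fun l => l + 1) hmem
  simp only [matchLevel] at h
  omega

lemma supplyCount_le_of_matchLevel_eq {k : ℕ} (h : matchLevel L γ x y = k + 1) :
    (supplyCount L k x (hypercube L k y) : ℝ) ≤ γ k := by
  have hne : (undersupplied L γ x y).Nonempty := by
    rw [Finset.nonempty_iff_ne_empty]
    intro he
    simp [matchLevel, he] at h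
  obtain ⟨j, hj, hj'⟩ := Finset.exists_mem_eq_sup _ hne (fun l => l + 1)
  have : j = k := by
    rw [matchLevel, hj'] at h; omega
  subst this
  simp only [undersupplied, Finset.mem_filter] at hj
  exact hj.2

lemma matchLevel_le_iff {k : ℕ} :
    matchLevel L γ x y ≤ k ↔
      ∀ j, k ≤ j → j ≤ L → γ j < supplyCount L j x (hypercube L j y) := by
  constructor
  · intro h j hj hjL
    exact lt_supplyCount hjL (h.trans hj)
  · intro h
    refine Finset.sup_le fun j hj => ?_
    simp only [undersupplied, Finset.mem_filter, Finset.mem_range] at hj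
    by_contra hlt
    have := h j (by omega) (by omega)
    linarith [hj.2]

variable {π : Policy d m}

/-- The hypercubes that contain the matched supply unit are those of the descent: below the match
level, each is a best-supplied child. -/
lemma IsHierarchicalGreedy.descent (hπ : IsHierarchicalGreedy L γ π) (htop : γ L < m)
    (x : Config d m) (y : Cube d) :
    hypercube L (matchLevel L γ x y) (x (π.choose x y)) = hypercube L (matchLevel L γ x y) y ∧
    ∀ l < matchLevel L γ x y, ∀ c, parent c = parent (hypercube L l (x (π.choose x y))) →
      supplyCount L l x c ≤ supplyCount L l x (hypercube L l (x (π.choose x y))) := by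
  obtain ⟨h, h1, h2, h3⟩ := hπ x y
  have hML := matchLevel_le (x := x) (y := y) htop
  have hh : ∀ l ≤ matchLevel L γ x y, h l = hypercube L l (x (π.choose x y)) := by
    intro l hl
    induction l with
    | zero => exact h3.symm
    | succ l ih =>
      have := (h2 l (by omega)).1
      rw [isChild_iff, mem_children] at this
      rw [← this, ih (by omega), parent_hypercube (by omega)]
  refine ⟨by rw [← hh _ le_rfl, h1], fun l hl c hc => ?_⟩
  rw [← hh l hl.le]
  refine (h2 l hl).2 c ?_
  rw [isChild_iff, mem_children, hc, parent_hypercube (by omega), hh _ (by omega)]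

lemma IsHierarchicalGreedy.hypercube_choose (hπ : IsHierarchicalGreedy L γ π) (htop : γ L < m)
    (x : Config d m) (y : Cube d) (hl : matchLevel L γ x y ≤ l) (hL : l ≤ L) :
    hypercube L l (x (π.choose x y)) = hypercube L l y :=
  hypercube_congr hl hL (hπ.descent htop x y).1

/-- A demand that is matched above level `l` takes a unit from a best-supplied child, where the
deficit is not positive. -/
lemma IsHierarchicalGreedy.deficit_choose (hπ : IsHierarchicalGreedy L γ π) (htop : γ L < m)
    (x : Config d m) (y : Cube d) (hl : l < matchLevel L γ x y) :
    deficit (fun h => (supplyCount L l x h : ℝ)) (hypercube L l (x (π.choose x y))) ≤ 0 := by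
  have h := (hπ.descent htop x y).2 l hl
  set c := hypercube L l (x (π.choose x y))
  rw [deficit, sub_nonpos, childAvg, div_le_iff₀ (by positivity)]
  calc ∑ c' ∈ children (parent c), (supplyCount L l x c' : ℝ)
      ≤ ∑ c' ∈ children (parent c), (supplyCount L l x c : ℝ) :=
        Finset.sum_le_sum fun c' hc' => by exact_mod_cast h c' (mem_children.1 hc')
    _ = _ := by rw [Finset.sum_const, card_children, nsmul_eq_mul]; push_cast; ring

open Classical in
/-- The first-order change of the potential caused by the demand unit. The indicator is the gain
from taking a unit of a best-supplied child in place of one of an undersupplied child; the other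
term vanishes on average over the location of the demand unit. -/
lemma IsHierarchicalGreedy.neg_gradient_le (hπ : IsHierarchicalGreedy L γ π) (htop : γ L < m)
    (hl : l < L) {a : ℝ} (ha : 0 < a) (hγ : 2 * a ≤ γ (l + 1) / 2 ^ d - γ l)
    (G : Finset (Fin d → ℕ)) (x : Config d m) (y : Cube d) :
    (if parent (hypercube L l (x (π.choose x y))) ∈ G then
      -1 * gradient a (fun h => (supplyCount L l x h : ℝ)) (hypercube L l (x (π.choose x y)))
      else 0) ≤
    (if hypercube L (l + 1) y ∈ G ∧ matchLevel L γ x y ≤ l + 1 then (-1 : ℝ) else 0) *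
      gradient a (fun h => (supplyCount L l x h : ℝ)) (hypercube L l y) -
    (if matchLevel L γ x y = l + 1 ∧ hypercube L (l + 1) y ∈ G then 1 else 0) := by
  set n : (Fin d → ℕ) → ℝ := fun h => (supplyCount L l x h : ℝ) with hn
  rcases lt_trichotomy (matchLevel L γ x y) (l + 1) with h | h | h
  · rw [hπ.hypercube_choose htop x y (by omega) hl.le, parent_hypercube hl]
    have h' : matchLevel L γ x y ≤ l + 1 := h.le
    simp only [h', h.ne, and_true, false_and, if_false]
    split_ifs <;> simp
  · have hc := hπ.hypercube_choose htop x y h.le hl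
    have hd := hπ.deficit_choose htop x y (l := l) (by omega)
    rw [parent_hypercube hl, hc]
    simp only [h, le_refl, and_true, true_and]
    split_ifs with hG
    · have hs1 : slope a (deficit n (hypercube L l y)) = 1 := by
        refine slope_eq_one ha (hγ.trans ?_)
        have h1 := lt_supplyCount (x := x) (y := y) hl h.le
        have h2 := supplyCount_le_of_matchLevel_eq h
        rw [supplyCount_succ hl] at h1
        rw [deficit, parent_hypercube hl, childAvg]
        have : γ (l + 1) / 2 ^ d ≤
            (∑ c ∈ children (hypercube L (l + 1) y), (supplyCount L l x c : ℝ)) / 2 ^ d :=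
          div_le_div_of_nonneg_right h1.le (by positivity)
        simp only [hn]
        linarith
      rw [gradient, gradient, parent_hypercube hl, parent_hypercube hl, hc, hs1,
        slope_eq_zero ha (hd.trans ha.le)]
      linarith
    · simp
  · have hd := hπ.deficit_choose htop x y (l := l) (by omega)
    simp only [not_le.2 h, h.ne', and_false, false_and, if_false, zero_mul, sub_zero]
    split_ifs
    · rw [gradient, slope_eq_zero ha (hd.trans ha.le)]
      have := childAvg_nonneg (F := fun c' => slope a (deficit n c')) (fun _ => slope_nonneg)
        (parent (hypercube L l (x (π.choose x y))))
      linarith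
    · exact le_rfl

/-- The event that the demand unit is matched at level `l + 1` from inside the region `G`. -/
def matchEvent (L : ℕ) (γ : ℕ → ℝ) (l : ℕ) (G : Finset (Fin d → ℕ)) :
    Set (Config d m × Cube d) :=
  {p | matchLevel L γ p.1 p.2 = l + 1 ∧ hypercube L (l + 1) p.2 ∈ G}

lemma measurableSet_matchEvent (γ : ℕ → ℝ) (l : ℕ) (G : Finset (Fin d → ℕ)) :
    MeasurableSet (matchEvent (m := m) L γ l G) :=
  (measurable_matchLevel γ (measurableSet_singleton (l + 1))).inter
    ((measurable_hypercube.comp measurable_snd) (Set.Finite.measurableSet G.finite_toSet))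

lemma configPotential_nonneg {a : ℝ} (ha : 0 < a) (G : Finset (Fin d → ℕ)) (x : Config d m) :
    0 ≤ configPotential L l a G x := potential_nonneg ha _ _

lemma configPotential_le {a : ℝ} (ha : 0 < a) (hl : l < L) {G : Finset (Fin d → ℕ)}
    (hG : G ⊆ grid d L (l + 1)) (x : Config d m) : configPotential L l a G x ≤ m :=
  potential_le ha hl hG x

lemma integrable_configPotential {α : Type*} [MeasurableSpace α] {ν : Measure α}
    [IsFiniteMeasure ν] {f : α → Config d m} (hf : Measurable f) {a : ℝ} (ha : 0 < a) (hl : l < L)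
    {G : Finset (Fin d → ℕ)} (hG : G ⊆ grid d L (l + 1)) :
    Integrable (fun z => configPotential L l a G (f z)) ν := by
  refine Integrable.of_bound ((measurable_configPotential a G).comp hf).aestronglyMeasurable m
    (ae_of_all _ fun z => ?_)
  rw [Real.norm_of_nonneg (configPotential_nonneg ha _ _)]
  exact configPotential_le ha hl hG _

/-- The drift of the potential from a given configuration. -/
lemma IsHierarchicalGreedy.integral_configPotential_next_le (hπ : IsHierarchicalGreedy L γ π)
    (htop : γ L < m) (hl : l < L) {a : ℝ} (ha : 0 < a) (hγ : 2 * a ≤ γ (l + 1) / 2 ^ d - γ l)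
    {G : Finset (Fin d → ℕ)} (hG : G ⊆ grid d L (l + 1)) (x : Config d m) :
    ∫ z : Cube d × Cube d, configPotential L l a G (nextConfig π x z.1 z.2) ≤
      configPotential L l a G x + 1 / a -
        volume.real {y : Cube d | (x, y) ∈ matchEvent L γ l G} := by
  classical
  have hint : Integrable fun z : Cube d × Cube d =>
      configPotential L l a G (nextConfig π x z.1 z.2) :=
    integrable_configPotential (f := fun z : Cube d × Cube d => nextConfig π x z.1 z.2)
      ((measurable_nextConfig π).comp (measurable_const.prodMk measurable_id)) ha hl hG
  set n : (Fin d → ℕ) → ℝ := fun h => (supplyCount L l x h : ℝ) with hn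
  -- Whether the match level is at most `l + 1` is determined by the hypercube of level `l + 1`, so
  -- `integral_gradient` applies to the demand units for which this holds.
  set W : (Fin d → ℕ) → ℝ := fun H =>
    if H ∈ G ∧ ∃ y' : Cube d, hypercube L (l + 1) y' = H ∧ matchLevel L γ x y' ≤ l + 1 then -1
      else 0 with hW
  have hWy : ∀ y : Cube d, W (hypercube L (l + 1) y) =
      if hypercube L (l + 1) y ∈ G ∧ matchLevel L γ x y ≤ l + 1 then -1 else 0 := by
    intro y
    simp only [hW]
    congr 2
    refine propext ⟨?_, fun h => ⟨y, rfl, h⟩⟩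
    rintro ⟨y', hy', h⟩
    rw [matchLevel_le_iff] at h ⊢
    intro j hj hjL
    rw [← hypercube_congr hj hjL hy']
    exact h j hj hjL
  have hset : MeasurableSet {y : Cube d | (x, y) ∈ matchEvent L γ l G} :=
    measurable_prodMk_left (measurableSet_matchEvent γ l G)
  have hpoint : ∀ y s : Cube d, configPotential L l a G (nextConfig π x y s) ≤
      (configPotential L l a G x + 1 / a +
        (W (hypercube L (l + 1) y) * gradient a n (hypercube L l y) -
          Set.indicator {y : Cube d | (x, y) ∈ matchEvent L γ l G} (fun _ => (1 : ℝ)) y)) +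
        (if hypercube L (l + 1) s ∈ G then (1 : ℝ) else 0) *
          gradient a (n + Pi.single (hypercube L l (x (π.choose x y))) (-1))
            (hypercube L l s) := by
    intro y s
    have h1 := potential_add_single ha G n (hypercube L l (x (π.choose x y)))
      (ε := -1) (by norm_num)
    have h2 := potential_add_single ha G
      (n + Pi.single (hypercube L l (x (π.choose x y))) (-1)) (hypercube L l s)
      (ε := 1) (by norm_num)
    have h3 := hπ.neg_gradient_le htop hl ha hγ G x y
    rw [← hWy] at h3
    rw [configPotential, nextConfig, supplyCount_update, configPotential]
    rw [parent_hypercube hl s] at h2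
    have h4 : Set.indicator {y : Cube d | (x, y) ∈ matchEvent L γ l G} (fun _ => (1 : ℝ)) y =
        if matchLevel L γ x y = l + 1 ∧ hypercube L (l + 1) y ∈ G then 1 else 0 := by
      simp [Set.indicator_apply, matchEvent]
    rw [h4]
    have h5 : 1 / a = 1 / (2 * a) + 1 / (2 * a) := by field_simp; norm_num
    have h6 : ∀ r : ℝ, (if hypercube L (l + 1) s ∈ G then (1 : ℝ) else 0) * r =
        if hypercube L (l + 1) s ∈ G then 1 * r else 0 := fun r => by split_ifs <;> simp
    rw [h6]
    linarith
  have hinner : ∀ y : Cube d, ∫ s : Cube d, configPotential L l a G (nextConfig π x y s) ≤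
      configPotential L l a G x + 1 / a +
        (W (hypercube L (l + 1) y) * gradient a n (hypercube L l y) -
          Set.indicator {y : Cube d | (x, y) ∈ matchEvent L γ l G} (fun _ => (1 : ℝ)) y) := by
    intro y
    set n' := n + Pi.single (hypercube L l (x (π.choose x y))) (-1)
    have hi2 := integrable_gradient hl a (fun H => if H ∈ G then (1 : ℝ) else 0) n'
    have hi1 : Integrable fun s : Cube d => configPotential L l a G (nextConfig π x y s) :=
      integrable_configPotential (f := fun s => nextConfig π x y s) ((measurable_nextConfig π).comp
        (measurable_const.prodMk (measurable_const.prodMk measurable_id))) ha hl hG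
    have h0 := integral_gradient hl a (fun H => if H ∈ G then (1 : ℝ) else 0) n'
    refine (integral_mono hi1 ((integrable_const _).add hi2) (hpoint y)).trans (le_of_eq ?_)
    simp only [Pi.add_apply]
    rw [integral_add (integrable_const _) hi2, h0]
    simp
  have hiW := integrable_gradient hl a W n
  have hiI : Integrable (Set.indicator {y : Cube d | (x, y) ∈ matchEvent L γ l G}
      (fun _ => (1 : ℝ))) := (integrable_const _).indicator hset
  rw [Measure.volume_eq_prod, integral_prod _ hint]
  refine (integral_mono hint.integral_prod_left ?_ hinner).trans (le_of_eq ?_)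
  · exact (integrable_const _).add (hiW.sub hiI)
  · have h0 := integral_gradient hl a W n
    have h1 := integral_add (integrable_const (μ := (volume : Measure (Cube d)))
      (configPotential L l a G x + 1 / a)) (hiW.sub hiI)
    simp only [Pi.sub_apply] at h1
    rw [h1, integral_sub hiW hiI, h0, integral_indicator_const _ hset]
    simp [sub_eq_add_neg]

end HG

/-! ### The law of the state -/

instance : IsProbabilityMeasure (arrivalLaw d) := by
  unfold arrivalLaw; infer_instance

/-- The law of the state at the beginning of period `t`. -/
def lawAt (π : Policy d m) (x₀ : Config d m) (t : ℕ) : Measure (Config d m) :=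
  (arrivalLaw d).map fun ω => configAt π x₀ ω t

/-- The law of the state after one period, when it has the law `ν` before. -/
def stepLaw (π : Policy d m) (ν : Measure (Config d m)) : Measure (Config d m) :=
  (ν.prod volume).map fun p : Config d m × (Cube d × Cube d) => nextConfig π p.1 p.2.1 p.2.2

lemma measurable_configAt (π : Policy d m) (x₀ : Config d m) (t : ℕ) :
    Measurable fun ω => configAt π x₀ ω t := by
  induction t with
  | zero => exact measurable_const
  | succ t ih => exact (measurable_nextConfig π).comp (ih.prodMk (measurable_pi_apply t))

lemma configAt_congr (π : Policy d m) (x₀ : Config d m) {t : ℕ} {ω ω' : Arrivals d}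
    (h : ∀ s < t, ω s = ω' s) : configAt π x₀ ω t = configAt π x₀ ω' t := by
  induction t with
  | zero => rfl
  | succ t ih =>
    simp only [configAt, ih fun s hs => h s (by omega), h t (by omega)]

instance (π : Policy d m) (x₀ : Config d m) (t : ℕ) : IsProbabilityMeasure (lawAt π x₀ t) :=
  Measure.isProbabilityMeasure_map (measurable_configAt π x₀ t).aemeasurable

lemma map_eval_arrivalLaw (t : ℕ) : (arrivalLaw d).map (fun ω => ω t) = volume :=
  Measure.infinitePi_map_eval _ t

/-- The state of a period is independent of the arrivals of the period. -/
lemma map_configAt_prodMk (π : Policy d m) (x₀ : Config d m) (t : ℕ) :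
    (arrivalLaw d).map (fun ω => (configAt π x₀ ω t, ω t)) = (lawAt π x₀ t).prod volume := by
  have hind : ProbabilityTheory.iIndepFun (fun (s : ℕ) (ω : Arrivals d) => ω s)
      (arrivalLaw d) := by
    rw [ProbabilityTheory.iIndepFun_iff_map_fun_eq_infinitePi_map fun s => measurable_pi_apply s]
    simp only [map_eval_arrivalLaw]
    exact Measure.map_id
  have h2 := hind.indepFun_finset (Finset.range t) {t} (by simp) fun s => measurable_pi_apply s
  classical
  let past : (Finset.range t → Cube d × Cube d) → Arrivals d := fun f s =>
    if hs : s ∈ Finset.range t then f ⟨s, hs⟩ else (0, 0)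
  have hpast : Measurable past := by
    refine measurable_pi_lambda _ fun s => ?_
    by_cases hs : s ∈ Finset.range t
    · simp only [past, dif_pos hs]
      exact measurable_pi_apply (⟨s, hs⟩ : Finset.range t)
    · simp only [past, dif_neg hs]
      exact measurable_const
  have h3 := h2.comp ((measurable_configAt π x₀ t).comp hpast)
    (measurable_pi_apply (⟨t, Finset.mem_singleton_self t⟩ : ({t} : Finset ℕ)))
  have h4 : (fun ω : Arrivals d => configAt π x₀ (past fun i : Finset.range t => ω i) t) =
      fun ω => configAt π x₀ ω t := by
    funext ω
    refine configAt_congr π x₀ fun s hs => ?_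
    simp [past, hs]
  have h5 : ProbabilityTheory.IndepFun (fun ω => configAt π x₀ ω t)
      (fun ω : Arrivals d => ω t) (arrivalLaw d) := by
    rw [← h4]; exact h3
  rw [(ProbabilityTheory.indepFun_iff_map_prod_eq_prod_map_map
    (measurable_configAt π x₀ t).aemeasurable (measurable_pi_apply t).aemeasurable).1 h5,
    map_eval_arrivalLaw]
  rfl

lemma lawAt_succ (π : Policy d m) (x₀ : Config d m) (t : ℕ) :
    lawAt π x₀ (t + 1) = stepLaw π (lawAt π x₀ t) := by
  rw [stepLaw, ← map_configAt_prodMk, Measure.map_map (measurable_nextConfig π)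
    ((measurable_configAt π x₀ t).prodMk (measurable_pi_apply t))]
  rfl

lemma lawAt_zero (π : Policy d m) (x₀ : Config d m) : lawAt π x₀ 0 = Measure.dirac x₀ := by
  simp [lawAt, configAt, Measure.map_const]

lemma measurable_eDist : Measurable fun p : Cube d × Cube d => eDist p.1 p.2 := by
  have h : Continuous fun x : Cube d =>
      (WithLp.toLp 2 (fun i => (x i : ℝ)) : EuclideanSpace ℝ (Fin d)) := by fun_prop
  exact ((h.comp continuous_fst).dist (h.comp continuous_snd)).measurable

lemma measurable_matchCost (π : Policy d m) :
    Measurable fun p : Config d m × Cube d => matchCost π p.1 p.2 := by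
  have hsel : Measurable fun p : Config d m × Cube d => p.1 (π.choose p.1 p.2) := by
    have h : Measurable fun q : Fin m × Config d m => q.2 q.1 :=
      measurable_from_prod_countable_right fun j => measurable_pi_apply j
    exact h.comp (π.measurable_choose.prodMk measurable_fst)
  have hpair : Measurable fun p : Config d m × Cube d => (p.2, p.1 (π.choose p.1 p.2)) :=
    measurable_snd.prodMk hsel
  have hcost := measurable_eDist.comp hpair
  simp only [matchCost]
  exact hcost

lemma eDist_le {x y : Cube d} {r : ℝ} (hr : 0 ≤ r) (h : ∀ i, |(x i : ℝ) - y i| ≤ r) :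
    eDist x y ≤ Real.sqrt d * r := by
  rw [eDist, EuclideanSpace.dist_eq]
  refine Real.sqrt_le_iff.2 ⟨by positivity, ?_⟩
  rw [mul_pow, Real.sq_sqrt (Nat.cast_nonneg d)]
  calc _ ≤ ∑ _i : Fin d, r ^ 2 := by
        refine Finset.sum_le_sum fun i _ => ?_
        rw [Real.dist_eq]
        exact pow_le_pow_left₀ (abs_nonneg _) (h i) 2
    _ = d * r ^ 2 := by simp

lemma eDist_nonneg (x y : Cube d) : 0 ≤ eDist x y := dist_nonneg

lemma eDist_le_sqrt (x y : Cube d) : eDist x y ≤ Real.sqrt d * 1 :=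
  eDist_le zero_le_one fun i => by
    rw [abs_le]
    constructor <;> linarith [(x i).2.1, (x i).2.2, (y i).2.1, (y i).2.2]

lemma integrable_matchCost {α : Type*} [MeasurableSpace α] {ν : Measure α} [IsFiniteMeasure ν]
    (π : Policy d m) {f : α → Config d m × Cube d} (hf : Measurable f) :
    Integrable (fun z => matchCost π (f z).1 (f z).2) ν := by
  refine Integrable.of_bound ((measurable_matchCost π).comp hf).aestronglyMeasurable
    (Real.sqrt d * 1) (ae_of_all _ fun z => ?_)
  rw [matchCost, Real.norm_of_nonneg (eDist_nonneg _ _)]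
  exact eDist_le_sqrt _ _

lemma avgCost_eq (π : Policy d m) (x₀ : Config d m) (N : ℕ) :
    avgCost π x₀ N = (∑ t ∈ Finset.range N, steadyCost π (lawAt π x₀ t)) / N := by
  have hm : ∀ t, Measurable fun ω : Arrivals d => (configAt π x₀ ω t, (ω t).1) := fun t =>
    (measurable_configAt π x₀ t).prodMk (measurable_fst.comp (measurable_pi_apply t))
  rw [avgCost, integral_div, integral_finsetSum _ fun t _ => integrable_matchCost π (hm t)]
  congr 1
  refine Finset.sum_congr rfl fun t _ => ?_
  have h1 : (arrivalLaw d).map (fun ω => (configAt π x₀ ω t, (ω t).1)) =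
      (lawAt π x₀ t).prod volume := by
    have hp : MeasurePreserving (Prod.map id Prod.fst :
        Config d m × (Cube d × Cube d) → Config d m × Cube d)
        ((lawAt π x₀ t).prod volume) ((lawAt π x₀ t).prod volume) :=
      (MeasurePreserving.id _).prod measurePreserving_fst
    rw [← hp.map_eq, ← map_configAt_prodMk, Measure.map_map hp.measurable
      ((measurable_configAt π x₀ t).prodMk (measurable_pi_apply t))]
    rfl
  rw [steadyCost, ← h1, integral_map (hm t).aemeasurable
    (measurable_matchCost π).aestronglyMeasurable]

/-! ### Bounds on the cost -/

lemma abs_sub_le_of_hypercube_eq {x y : Cube d} (h : hypercube L l x = hypercube L l y)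
    (i : Fin d) : |(x i : ℝ) - y i| ≤ (2 ^ (L - l))⁻¹ := by
  have h2 : (0 : ℝ) < 2 ^ (L - l) := by positivity
  have key : ∀ t : unitInterval, ∀ n : ℕ, min ⌊(2 : ℝ) ^ (L - l) * (t : ℝ)⌋₊ (2 ^ (L - l) - 1) = n →
      (n : ℝ) ≤ 2 ^ (L - l) * (t : ℝ) ∧ 2 ^ (L - l) * (t : ℝ) ≤ n + 1 := by
    intro t n hn
    have h0 : 0 ≤ (2 : ℝ) ^ (L - l) * (t : ℝ) := mul_nonneg h2.le t.2.1
    subst hn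
    constructor
    · refine le_trans ?_ (Nat.floor_le h0)
      exact_mod_cast min_le_left _ _
    · rcases min_cases ⌊(2 : ℝ) ^ (L - l) * (t : ℝ)⌋₊ (2 ^ (L - l) - 1) with h | h
      · rw [h.1]; exact (Nat.lt_floor_add_one _).le
      · rw [h.1, Nat.cast_sub Nat.one_le_two_pow]
        push_cast
        nlinarith [t.2.2]
  have hx := key (x i) _ (congrFun h i)
  have hy := key (y i) _ rfl
  simp only [hypercube] at hx
  rw [← one_div, le_div_iff₀ h2, ← abs_of_pos h2, ← abs_mul, abs_le]
  constructor <;> linarith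

section HG
variable {γ : ℕ → ℝ} {π : Policy d m}

lemma IsHierarchicalGreedy.matchCost_le (hπ : IsHierarchicalGreedy L γ π) (htop : γ L < m)
    (x : Config d m) (y : Cube d) :
    matchCost π x y ≤ Real.sqrt d / 2 ^ L * (1 + ∑ l ∈ Finset.range L, 2 ^ (l + 1) *
      Set.indicator {p : Config d m × Cube d | matchLevel L γ p.1 p.2 = l + 1}
        (fun _ => (1 : ℝ)) (x, y)) := by
  have hML := matchLevel_le (x := x) (y := y) htop
  have h1 : matchCost π x y ≤ Real.sqrt d * (2 ^ (L - matchLevel L γ x y))⁻¹ :=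
    eDist_le (by positivity) (abs_sub_le_of_hypercube_eq (hπ.descent htop x y).1.symm)
  have h2 : ((2 : ℝ) ^ (L - matchLevel L γ x y))⁻¹ = 2 ^ matchLevel L γ x y / 2 ^ L := by
    rw [pow_sub₀ _ two_ne_zero hML]; field_simp
  refine h1.trans ?_
  rw [h2, div_mul_eq_mul_div, mul_div_assoc]
  refine mul_le_mul_of_nonneg_left ?_ (Real.sqrt_nonneg _)
  refine div_le_div_of_nonneg_right ?_ (by positivity)
  have hnn : ∀ k ∈ Finset.range L, (0 : ℝ) ≤ 2 ^ (k + 1) *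
      Set.indicator {p : Config d m × Cube d | matchLevel L γ p.1 p.2 = k + 1}
        (fun _ => (1 : ℝ)) (x, y) := fun k _ =>
    mul_nonneg (by positivity) (Set.indicator_nonneg (fun _ _ => zero_le_one) _)
  rcases hk : matchLevel L γ x y with _ | k
  · simpa using Finset.sum_nonneg hnn
  · have := Finset.single_le_sum hnn (Finset.mem_range.2 (show k < L by omega))
    rw [Set.indicator_of_mem (by exact hk)] at this
    linarith

lemma IsHierarchicalGreedy.steadyCost_le (hπ : IsHierarchicalGreedy L γ π) (htop : γ L < m)
    (ν : Measure (Config d m)) [IsProbabilityMeasure ν] :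
    steadyCost π ν ≤ Real.sqrt d / 2 ^ L * (1 + ∑ l ∈ Finset.range L, 2 ^ (l + 1) *
      (ν.prod volume).real {p : Config d m × Cube d | matchLevel L γ p.1 p.2 = l + 1}) := by
  have hm : ∀ k, MeasurableSet {p : Config d m × Cube d | matchLevel L γ p.1 p.2 = k + 1} :=
    fun k => measurable_matchLevel γ (measurableSet_singleton (k + 1))
  have hi : ∀ k ∈ Finset.range L, Integrable (fun p => 2 ^ (k + 1) *
      Set.indicator {p : Config d m × Cube d | matchLevel L γ p.1 p.2 = k + 1}
        (fun _ => (1 : ℝ)) p) (ν.prod volume) := fun k _ =>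
    ((integrable_const _).indicator (hm k)).const_mul _
  have hs := integrable_finsetSum _ hi
  refine (integral_mono (integrable_matchCost π measurable_id)
    (((integrable_const 1).add hs).const_mul (Real.sqrt d / 2 ^ L))
    fun p => hπ.matchCost_le htop p.1 p.2).trans (le_of_eq ?_)
  rw [integral_const_mul]
  simp only [Pi.add_apply]
  rw [integral_add (integrable_const 1) hs, integral_finsetSum _ hi]
  congr 2
  · simp
  · refine Finset.sum_congr rfl fun k _ => ?_
    rw [integral_const_mul, integral_indicator_const _ (hm k)]
    simp

/-- The drift of the potential in one period. -/
lemma IsHierarchicalGreedy.integral_stepLaw_le (hπ : IsHierarchicalGreedy L γ π)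
    (htop : γ L < m) (hl : l < L) {a : ℝ} (ha : 0 < a) (hγ : 2 * a ≤ γ (l + 1) / 2 ^ d - γ l)
    {G : Finset (Fin d → ℕ)} (hG : G ⊆ grid d L (l + 1))
    (ν : Measure (Config d m)) [IsProbabilityMeasure ν] :
    ∫ x, configPotential L l a G x ∂(stepLaw π ν) + (ν.prod volume).real (matchEvent L γ l G) ≤
      ∫ x, configPotential L l a G x ∂ν + 1 / a := by
  have hset := measurableSet_matchEvent (d := d) (m := m) (L := L) γ l G
  have hi : Integrable (fun p : Config d m × (Cube d × Cube d) =>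
      configPotential L l a G (nextConfig π p.1 p.2.1 p.2.2)) (ν.prod volume) :=
    integrable_configPotential (measurable_nextConfig π) ha hl hG
  have hE : (ν.prod volume).real (matchEvent L γ l G) =
      ∫ x, volume.real {y : Cube d | (x, y) ∈ matchEvent L γ l G} ∂ν := by
    rw [measureReal_def, Measure.prod_apply hset, ← integral_toReal]
    · rfl
    · exact (measurable_measure_prodMk_left hset).aemeasurable
    · exact ae_of_all _ fun x => measure_lt_top _ _
  have hiE : Integrable (fun x => volume.real {y : Cube d | (x, y) ∈ matchEvent L γ l G}) ν := by
    refine Integrable.of_bound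
      (measurable_measure_prodMk_left hset).ennreal_toReal.aestronglyMeasurable 1
      (ae_of_all _ fun x => ?_)
    rw [Real.norm_of_nonneg measureReal_nonneg]
    exact measureReal_le_one
  have hiΦ : Integrable (configPotential (m := m) L l a G) ν :=
    integrable_configPotential measurable_id ha hl hG
  rw [stepLaw, integral_map (measurable_nextConfig π).aemeasurable
    (measurable_configPotential a G).aestronglyMeasurable, integral_prod _ hi, hE,
    ← integral_add hi.integral_prod_left hiE]
  have h1 : ∫ x, configPotential L l a G x ∂ν + 1 / a =
      ∫ x, (configPotential L l a G x + 1 / a) ∂ν := by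
    rw [integral_add hiΦ (integrable_const _)]; simp
  rw [h1]
  refine integral_mono (hi.integral_prod_left.add hiE) (hiΦ.add (integrable_const _)) fun x => ?_
  have := hπ.integral_configPotential_next_le htop hl ha hγ hG x
  simp only
  linarith

/-- The drift summed over `N` periods, where the final potential is dropped. -/
lemma IsHierarchicalGreedy.sum_matchEvent_le (hπ : IsHierarchicalGreedy L γ π)
    (htop : γ L < m) (hl : l < L) {a : ℝ} (ha : 0 < a) (hγ : 2 * a ≤ γ (l + 1) / 2 ^ d - γ l)
    {G : Finset (Fin d → ℕ)} (hG : G ⊆ grid d L (l + 1)) (x : Config d m) (N : ℕ) :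
    ∑ t ∈ Finset.range N, ((lawAt π x t).prod volume).real (matchEvent L γ l G) ≤
      configPotential L l a G x + N / a := by
  have key : ∑ t ∈ Finset.range N, ((lawAt π x t).prod volume).real (matchEvent L γ l G) +
      ∫ x', configPotential L l a G x' ∂(lawAt π x N) ≤ configPotential L l a G x + N / a := by
    induction N with
    | zero => simp [lawAt_zero, integral_dirac' _ _
        (measurable_configPotential (m := m) (L := L) (l := l) a G).stronglyMeasurable]
    | succ N ih =>
      have := hπ.integral_stepLaw_le htop hl ha hγ hG (lawAt π x N)
      rw [Finset.sum_range_succ, lawAt_succ]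
      push_cast
      rw [add_div]
      linarith
  have : 0 ≤ ∫ x', configPotential L l a G x' ∂(lawAt π x N) :=
    integral_nonneg fun _ => configPotential_nonneg ha _ _
  linarith

lemma matchEvent_grid : matchEvent (m := m) L γ l (grid d L (l + 1)) =
    {p : Config d m × Cube d | matchLevel L γ p.1 p.2 = l + 1} := by
  ext p; simp [matchEvent, hypercube_mem_grid]

lemma IsHierarchicalGreedy.matchLevel_prob_le_of_isStationary (hπ : IsHierarchicalGreedy L γ π)
    (htop : γ L < m) (hl : l < L) {a : ℝ} (ha : 0 < a) (hγ : 2 * a ≤ γ (l + 1) / 2 ^ d - γ l)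
    {μ : Measure (Config d m)} (hμ : IsStationary π μ) :
    (μ.prod volume).real {p : Config d m × Cube d | matchLevel L γ p.1 p.2 = l + 1} ≤ 1 / a := by
  have := hμ.1
  have h := hπ.integral_stepLaw_le htop hl ha hγ subset_rfl μ
  rw [stepLaw, hμ.2, matchEvent_grid] at h
  linarith

/-- From an arbitrary initial state, the transient adds at most `m` matches at each level. -/
lemma IsHierarchicalGreedy.sum_matchLevel_prob_le (hπ : IsHierarchicalGreedy L γ π)
    (htop : γ L < m) (hl : l < L) {a : ℝ} (ha : 0 < a) (hγ : 2 * a ≤ γ (l + 1) / 2 ^ d - γ l)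
    (x : Config d m) (N : ℕ) :
    ∑ t ∈ Finset.range N, ((lawAt π x t).prod volume).real
      {p : Config d m × Cube d | matchLevel L γ p.1 p.2 = l + 1} ≤ m + N / a := by
  have h := hπ.sum_matchEvent_le htop hl ha hγ subset_rfl x N
  rw [matchEvent_grid] at h
  linarith [configPotential_le ha hl subset_rfl x]

end HG

/-! ### Evenly spread initial locations -/

/-- The number of supply units in the level-`l` hypercube `h` that lie on an upper face of the unit
cube. The half-open cubes in the definition of `EvenlySpread` do not see these units. -/
def faceCount (L l : ℕ) (x : Config d m) (h : Fin d → ℕ) : ℕ :=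
  (Finset.univ.filter fun i => hypercube L l (x i) = h ∧ ∃ k, (x i k : ℝ) = 1).card

/-- The number of supply units in the half-open cube with lower corner `a` and side `s`. -/
def boxCount (x : Config d m) (a : Fin d → ℝ) (s : ℝ) : ℕ :=
  (Finset.univ.filter fun i => ∀ k, a k ≤ (x i k : ℝ) ∧ (x i k : ℝ) < a k + s).card

lemma boxCount_le_supplyCount {c : Fin d → ℕ} (hc : c ∈ grid d L l) (x : Config d m) :
    boxCount x (fun k => (c k : ℝ) / 2 ^ (L - l)) (1 / 2 ^ (L - l)) ≤ supplyCount L l x c := by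
  refine Finset.card_le_card fun i => ?_
  simp only [Finset.mem_filter, Finset.mem_univ, true_and]
  intro h
  funext k
  have hk := h k
  rw [← add_div] at hk
  have hck := mem_grid.1 hc k
  have hc1 : (c k : ℝ) + 1 ≤ 2 ^ (L - l) := by exact_mod_cast hck
  refine (min_floor_eq_iff hck ?_).2 ⟨hk.1, hk.2⟩
  refine hk.2.trans_le ?_
  rw [div_le_one (by positivity)]
  exact hc1

lemma supplyCount_le_boxCount_add {c : Fin d → ℕ} (hc : c ∈ grid d L l) (x : Config d m) :
    supplyCount L l x c ≤
      boxCount x (fun k => (c k : ℝ) / 2 ^ (L - l)) (1 / 2 ^ (L - l)) + faceCount L l x c := by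
  refine le_trans (Finset.card_le_card fun i => ?_) (Finset.card_union_le _ _)
  simp only [Finset.mem_filter, Finset.mem_univ, true_and, Finset.mem_union]
  intro h
  by_cases hf : ∃ k, (x i k : ℝ) = 1
  · exact Or.inr ⟨h, hf⟩
  · push Not at hf
    left
    intro k
    rw [← add_div]
    exact (min_floor_eq_iff (mem_grid.1 hc k) (lt_of_le_of_ne (x i k).2.2 (hf k))).1 (congrFun h k)

lemma EvenlySpread.abs_boxCount_sub_le {K : ℝ} {x : Config d m} (hx : EvenlySpread K x)
    {c : Fin d → ℕ} (hc : c ∈ grid d L l) :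
    |(boxCount x (fun k => (c k : ℝ) / 2 ^ (L - l)) (1 / 2 ^ (L - l)) : ℝ) -
      m * (1 / 2 ^ (L - l)) ^ d| ≤
        K * (1 + (m : ℝ) ^ (1 / (d : ℝ)) * (1 / 2 ^ (L - l))) ^ (d - 1) := by
  have h := hx (fun k => (c k : ℝ) / 2 ^ (L - l)) (1 / 2 ^ (L - l)) (by positivity) fun k => by
    refine ⟨by positivity, ?_⟩
    rw [← add_div, div_le_one (by positivity)]
    exact_mod_cast mem_grid.1 hc k
  exact h

lemma EvenlySpread.sum_faceCount_le {K : ℝ} {x : Config d m} (hx : EvenlySpread K x) :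
    ∑ H ∈ grid d L l, (faceCount L l x H : ℝ) ≤ K * (1 + (m : ℝ) ^ (1 / (d : ℝ))) ^ (d - 1) := by
  have h := hx 0 1 zero_le_one fun k => by simp
  have h1 : ∑ H ∈ grid d L l, faceCount L l x H =
      (Finset.univ.filter fun i => ∃ k, (x i k : ℝ) = 1).card := by
    rw [Finset.card_eq_sum_card_fiberwise (f := fun i => hypercube L l (x i)) (t := grid d L l)
      fun i _ => hypercube_mem_grid _]
    refine Finset.sum_congr rfl fun H _ => ?_
    rw [Finset.filter_filter]
    unfold faceCount
    congr 1
    ext i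
    simp [and_comm]
  have h2 : (Finset.univ.filter fun i => ∃ k, (x i k : ℝ) = 1).card +
      (Finset.univ.filter fun i : Fin m => ∀ k, (0 : Fin d → ℝ) k ≤ (x i k : ℝ) ∧
        (x i k : ℝ) < (0 : Fin d → ℝ) k + 1).card = m := by
    rw [← Finset.card_union_of_disjoint]
    · have : (Finset.univ.filter fun i => ∃ k, (x i k : ℝ) = 1) ∪
        (Finset.univ.filter fun i : Fin m => ∀ k, (0 : Fin d → ℝ) k ≤ (x i k : ℝ) ∧
        (x i k : ℝ) < (0 : Fin d → ℝ) k + 1) = Finset.univ := by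
        ext i
        simp only [Finset.mem_union, Finset.mem_filter, Finset.mem_univ, true_and, iff_true]
        by_cases hf : ∃ k, (x i k : ℝ) = 1
        · exact Or.inl hf
        · push Not at hf
          refine Or.inr fun k => ⟨(x i k).2.1, ?_⟩
          rw [Pi.zero_apply, zero_add]
          exact lt_of_le_of_ne (x i k).2.2 (hf k)
      rw [this, Finset.card_univ, Fintype.card_fin]
    · rw [Finset.disjoint_filter]
      rintro i - ⟨k, hk⟩ h
      have := (h k).2
      rw [hk] at this
      simp at this
  rw [mul_one, one_pow, mul_one] at h
  have h3 := (abs_le.1 h).1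
  rw [← Nat.cast_sum, h1]
  have h4 := congrArg (Nat.cast (R := ℝ)) h2
  push_cast at h4
  linarith

/-- In an evenly spread configuration, a large deficit is only possible next to an accumulation
of units on the upper faces of the unit cube. -/
lemma EvenlySpread.deficit_le {K : ℝ} (hK : 0 ≤ K) {x : Config d m} (hx : EvenlySpread K x)
    (hl : l < L) (hM : (m : ℝ) ^ (1 / (d : ℝ)) ≤ 2 * 2 ^ L) {c : Fin d → ℕ}
    (hc : c ∈ grid d L l) :
    deficit (fun h => (supplyCount L l x h : ℝ)) c ≤
      2 * (K * (5 * 2 ^ l) ^ (d - 1)) + faceCount L (l + 1) x (parent c) := by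
  have hp := (parent_mem_grid hl).2 hc
  have h2 : (2 : ℝ) ^ (L - l) = 2 * 2 ^ (L - (l + 1)) := by
    rw [← pow_succ']; congr 1; omega
  have hs : (1 : ℝ) / 2 ^ (L - (l + 1)) = 2 * (1 / 2 ^ (L - l)) := by
    rw [h2]; field_simp
  have hsL : (2 : ℝ) ^ L * (1 / 2 ^ (L - l)) = 2 ^ l := by
    rw [pow_sub₀ _ two_ne_zero hl.le]; field_simp
  have h1 := (abs_le.1 (hx.abs_boxCount_sub_le hc)).1
  have h3 := (abs_le.1 (hx.abs_boxCount_sub_le hp)).2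
  have h4 := boxCount_le_supplyCount hc x
  have h5 := supplyCount_le_boxCount_add hp x
  rw [← Nat.cast_le (α := ℝ)] at h4 h5
  push_cast at h5
  have hmono : ∀ r : ℝ, 0 ≤ r → r ≤ 2 * (1 / 2 ^ (L - l)) →
      K * (1 + (m : ℝ) ^ (1 / (d : ℝ)) * r) ^ (d - 1) ≤ K * (5 * 2 ^ l) ^ (d - 1) := by
    intro r hr0 hr
    refine mul_le_mul_of_nonneg_left (pow_le_pow_left₀ (by positivity) ?_ _) hK
    have : (m : ℝ) ^ (1 / (d : ℝ)) * r ≤ 2 * 2 ^ L * (2 * (1 / 2 ^ (L - l))) :=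
      mul_le_mul hM hr hr0 (by positivity)
    have h1l : (1 : ℝ) ≤ 2 ^ l := one_le_pow₀ (by norm_num)
    have : 2 * 2 ^ L * (2 * (1 / 2 ^ (L - l))) = 4 * ((2 : ℝ) ^ L * (1 / 2 ^ (L - l))) := by ring
    rw [hsL] at this
    linarith
  have hpos : (0 : ℝ) ≤ 1 / 2 ^ (L - l) := by positivity
  have h6 := hmono (1 / 2 ^ (L - l)) hpos (by linarith)
  have h7 := hmono (1 / 2 ^ (L - (l + 1))) (by positivity) hs.le
  have hm : (m : ℝ) * (1 / 2 ^ (L - (l + 1))) ^ d = 2 ^ d * (m * (1 / 2 ^ (L - l)) ^ d) := by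
    rw [hs, mul_pow]; ring
  rw [hm] at h3
  have hD : (1 : ℝ) ≤ 2 ^ d := one_le_pow₀ (by norm_num)
  have hD0 : (0 : ℝ) < 2 ^ d := by positivity
  rw [deficit, childAvg, ← supplyCount_succ hl]
  have hE : 0 ≤ K * (5 * 2 ^ l) ^ (d - 1) := by positivity
  have hB : (0 : ℝ) ≤ faceCount L (l + 1) x (parent c) := Nat.cast_nonneg _
  have h8 : (supplyCount L (l + 1) x (parent c) : ℝ) / 2 ^ d ≤
      m * (1 / 2 ^ (L - l)) ^ d + K * (5 * 2 ^ l) ^ (d - 1) +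
        faceCount L (l + 1) x (parent c) := by
    rw [div_le_iff₀ hD0]
    nlinarith
  linarith

section HG
variable {γ : ℕ → ℝ} {π : Policy d m}

/-- Matches at level `l + 1` are rare at all times if the initial locations are evenly spread:
hypercubes without an accumulation on the upper faces start with zero potential, and there are few
others. -/
lemma IsHierarchicalGreedy.sum_matchLevel_prob_le_of_evenlySpread
    (hπ : IsHierarchicalGreedy L γ π) (htop : γ L < m) (hl : l < L) {a : ℝ} (ha : 0 < a)
    (hγ : 2 * a ≤ γ (l + 1) / 2 ^ d - γ l) {K : ℝ} (hK : 0 ≤ K) {x : Config d m}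
    (hx : EvenlySpread K x) (hM : (m : ℝ) ^ (1 / (d : ℝ)) ≤ 2 * 2 ^ L)
    (hKa : 2 * (K * (5 * 2 ^ l) ^ (d - 1)) ≤ a / 2) (N : ℕ) :
    ∑ t ∈ Finset.range N, ((lawAt π x t).prod volume).real
      {p : Config d m × Cube d | matchLevel L γ p.1 p.2 = l + 1} ≤
    N * (1 / a + 2 / a * (K * (3 * 2 ^ L) ^ (d - 1)) * (2 ^ ((L - (l + 1)) * d))⁻¹) := by
  classical
  set n : (Fin d → ℕ) → ℝ := fun h => (supplyCount L l x h : ℝ) with hn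
  set G := (grid d L (l + 1)).filter fun H => ∀ c ∈ children H, deficit n c ≤ a with hG
  set bad := (grid d L (l + 1)).filter fun H => ¬ ∀ c ∈ children H, deficit n c ≤ a with hbad
  have hΦ : configPotential L l a G x = 0 := by
    refine Finset.sum_eq_zero fun H hH => Finset.sum_eq_zero fun c hc => ?_
    exact huber_eq_zero ha ((Finset.mem_filter.1 hH).2 c hc)
  have hcard : (bad.card : ℝ) ≤ 2 / a * (K * (3 * 2 ^ L) ^ (d - 1)) := by
    have h1 : ∀ H ∈ bad, a / 2 ≤ (faceCount L (l + 1) x H : ℝ) := by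
      intro H hH
      rw [hbad, Finset.mem_filter] at hH
      obtain ⟨hHg, hH⟩ := hH
      push Not at hH
      obtain ⟨c, hc, hac⟩ := hH
      rw [mem_children] at hc
      subst hc
      have := hx.deficit_le hK hl hM ((parent_mem_grid hl).1 hHg)
      linarith
    have h2 : (bad.card : ℝ) * (a / 2) ≤ K * (3 * 2 ^ L) ^ (d - 1) := by
      calc (bad.card : ℝ) * (a / 2) = ∑ _H ∈ bad, a / 2 := by simp
        _ ≤ ∑ H ∈ bad, (faceCount L (l + 1) x H : ℝ) := Finset.sum_le_sum h1
        _ ≤ ∑ H ∈ grid d L (l + 1), (faceCount L (l + 1) x H : ℝ) :=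
          Finset.sum_le_sum_of_subset_of_nonneg (Finset.filter_subset _ _)
            fun _ _ _ => Nat.cast_nonneg _
        _ ≤ K * (1 + (m : ℝ) ^ (1 / (d : ℝ))) ^ (d - 1) := hx.sum_faceCount_le
        _ ≤ K * (3 * 2 ^ L) ^ (d - 1) := by
          refine mul_le_mul_of_nonneg_left (pow_le_pow_left₀ (by positivity) ?_ _) hK
          have : (1 : ℝ) ≤ 2 ^ L := one_le_pow₀ (by norm_num)
          linarith
    rw [div_mul_eq_mul_div, le_div_iff₀ ha]
    linarith
  have hprob : ∀ t, ((lawAt π x t).prod volume).real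
      {p : Config d m × Cube d | matchLevel L γ p.1 p.2 = l + 1} ≤
      ((lawAt π x t).prod volume).real (matchEvent L γ l G) +
        bad.card * (2 ^ ((L - (l + 1)) * d))⁻¹ := by
    intro t
    have hsub : {p : Config d m × Cube d | matchLevel L γ p.1 p.2 = l + 1} ⊆
        matchEvent L γ l G ∪ ⋃ H ∈ bad, Set.univ ×ˢ {y : Cube d | hypercube L (l + 1) y = H} := by
      intro p hp
      by_cases hpG : hypercube L (l + 1) p.2 ∈ G
      · exact Or.inl ⟨hp, hpG⟩
      · right
        have : hypercube L (l + 1) p.2 ∈ bad := by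
          rw [hbad, Finset.mem_filter]
          refine ⟨hypercube_mem_grid _, fun h => hpG ?_⟩
          rw [hG, Finset.mem_filter]
          exact ⟨hypercube_mem_grid _, h⟩
        simp only [Set.mem_iUnion]
        exact ⟨_, this, trivial, rfl⟩
    refine (measureReal_mono hsub).trans ((measureReal_union_le _ _).trans ?_)
    refine add_le_add le_rfl ((measureReal_biUnion_finset_le _ _).trans ?_)
    rw [← nsmul_eq_mul]
    refine Finset.sum_le_card_nsmul _ _ _ fun H hH => le_of_eq ?_
    rw [measureReal_prod_prod, probReal_univ, one_mul, measureReal_def,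
      volume_hypercube_eq (Finset.mem_filter.1 hH).1, ENNReal.toReal_ofReal (by positivity)]
  have hsum := hπ.sum_matchEvent_le htop hl ha hγ (Finset.filter_subset _ _ : G ⊆ _) x N
  rw [hΦ, zero_add] at hsum
  calc _ ≤ ∑ t ∈ Finset.range N, (((lawAt π x t).prod volume).real (matchEvent L γ l G) +
        bad.card * (2 ^ ((L - (l + 1)) * d))⁻¹) := Finset.sum_le_sum fun t _ => hprob t
    _ = ∑ t ∈ Finset.range N, ((lawAt π x t).prod volume).real (matchEvent L γ l G) +
        N * (bad.card * (2 ^ ((L - (l + 1)) * d))⁻¹) := by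
        rw [Finset.sum_add_distrib, Finset.sum_const, Finset.card_range, nsmul_eq_mul]
    _ ≤ N / a + N * (2 / a * (K * (3 * 2 ^ L) ^ (d - 1)) * (2 ^ ((L - (l + 1)) * d))⁻¹) := by
        refine add_le_add hsum (mul_le_mul_of_nonneg_left ?_ (Nat.cast_nonneg _))
        exact mul_le_mul_of_nonneg_right hcard (by positivity)
    _ = _ := by ring

end HG

/-! ### A Hierarchical Greedy policy with a stationary distribution -/

open scoped ENNReal

/-- A finite Markov chain has a stationary distribution: the absolute values of a left eigenvector
for the eigenvalue `1` form one, up to normalization. -/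
lemma exists_stationary_of_finite {V : Type*} [Fintype V] [Nonempty V] (P : V → V → ℝ≥0∞)
    (hP : ∀ v, ∑ v', P v v' = 1) :
    ∃ p : V → ℝ≥0∞, ∑ v, p v = 1 ∧ ∀ v', ∑ v, p v * P v v' = p v' := by
  classical
  have hPtop : ∀ v v', P v v' ≠ ∞ := fun v v' => ne_top_of_le_ne_top ENNReal.one_ne_top
    ((Finset.single_le_sum (fun _ _ => zero_le) (Finset.mem_univ v')).trans (hP v).le)
  have hPr : ∀ v, ∑ v', (P v v').toReal = 1 := fun v => by
    rw [← ENNReal.toReal_sum fun v' _ => hPtop v v', hP, ENNReal.toReal_one]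
  let A : Matrix V V ℝ := fun v v' => (P v v').toReal
  have hdet : (A - 1).det = 0 := by
    rw [← Matrix.exists_mulVec_eq_zero_iff]
    refine ⟨1, one_ne_zero, ?_⟩
    rw [Matrix.sub_mulVec, Matrix.one_mulVec, sub_eq_zero]
    funext v
    simpa [A, Matrix.mulVec, dotProduct] using hPr v
  obtain ⟨w, hw0, hw⟩ := Matrix.exists_vecMul_eq_zero_iff.2 hdet
  have hw1 : ∀ v', ∑ v, w v * (P v v').toReal = w v' := by
    intro v'
    rw [Matrix.vecMul_sub, Matrix.vecMul_one, sub_eq_zero] at hw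
    exact congrFun hw v'
  have hle : ∀ v' ∈ Finset.univ, |w v'| ≤ ∑ v, |w v| * (P v v').toReal := by
    intro v' _
    rw [← hw1 v']
    refine (Finset.abs_sum_le_sum_abs _ _).trans (le_of_eq ?_)
    simp [abs_mul]
  have hsum : ∑ v', |w v'| = ∑ v', ∑ v, |w v| * (P v v').toReal := by
    rw [Finset.sum_comm]
    simp [← Finset.mul_sum, hPr]
  have heq := (Finset.sum_eq_sum_iff_of_le hle).1 hsum
  have hpos : 0 < ∑ v, |w v| := by
    obtain ⟨v, hv⟩ := Function.ne_iff.1 hw0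
    exact Finset.sum_pos' (fun _ _ => abs_nonneg _) ⟨v, Finset.mem_univ v, abs_pos.2 hv⟩
  have hp0 : ∀ v, 0 ≤ |w v| / ∑ v, |w v| := fun v => by positivity
  refine ⟨fun v => ENNReal.ofReal (|w v| / ∑ v, |w v|), ?_, fun v' => ?_⟩
  · rw [← ENNReal.ofReal_sum_of_nonneg fun v _ => hp0 v, ← Finset.sum_div, div_self hpos.ne',
      ENNReal.ofReal_one]
  · have : ∀ v, ENNReal.ofReal (|w v| / ∑ v, |w v|) * P v v' =
        ENNReal.ofReal (|w v| / (∑ v, |w v|) * (P v v').toReal) := fun v => by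
      rw [ENNReal.ofReal_mul (hp0 v), ENNReal.ofReal_toReal (hPtop v v')]
    simp only [this]
    rw [← ENNReal.ofReal_sum_of_nonneg fun v _ => mul_nonneg (hp0 v) ENNReal.toReal_nonneg,
      heq v' (Finset.mem_univ v'), Finset.sum_div]
    congr 1
    exact Finset.sum_congr rfl fun v _ => by ring

lemma measurable_update_fst {ι E : Type*} [DecidableEq ι] [MeasurableSpace E] (j : ι) :
    Measurable fun p : (ι → E) × E => Function.update p.1 j p.2 := by
  refine measurable_pi_lambda _ fun i => ?_
  by_cases h : i = j
  · subst h; simpa using measurable_snd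
  · simp only [Function.update_of_ne h]
    exact (measurable_pi_apply i).comp measurable_fst

/-- Replacing one coordinate of a random vector with independent coordinates. -/
lemma map_update_pi {ι E : Type*} [Fintype ι] [DecidableEq ι] [MeasurableSpace E]
    (ν : ι → Measure E) [∀ i, IsProbabilityMeasure (ν i)] (τ : Measure E)
    [IsProbabilityMeasure τ] (j : ι) :
    ((Measure.pi ν).prod τ).map (fun p => Function.update p.1 j p.2) =
      Measure.pi (Function.update ν j τ) := by
  have : ∀ i, IsProbabilityMeasure (Function.update ν j τ i) := by
    intro i
    by_cases h : i = j
    · subst h; simpa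
    · simp only [Function.update_of_ne h]; infer_instance
  symm
  refine Measure.pi_eq fun s hs => ?_
  rw [Measure.map_apply (measurable_update_fst j) (MeasurableSet.univ_pi hs)]
  have hpre : (fun p : (ι → E) × E => Function.update p.1 j p.2) ⁻¹' Set.univ.pi s =
      (Set.univ.pi (Function.update s j Set.univ)) ×ˢ s j := by
    ext p
    simp only [Set.mem_preimage, Set.mem_univ_pi, Set.mem_prod]
    constructor
    · intro h
      refine ⟨fun i => ?_, by simpa using h j⟩
      by_cases hi : i = j
      · subst hi; simp
      · simpa [Function.update_of_ne hi] using h i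
    · rintro ⟨h1, h2⟩ i
      by_cases hi : i = j
      · subst hi; simpa
      · simpa [Function.update_of_ne hi] using h1 i
  rw [hpre, Measure.prod_prod, Measure.pi_pi, ← Finset.mul_prod_erase _ _ (Finset.mem_univ j),
    ← Finset.mul_prod_erase _ (fun i => Function.update ν j τ i (s i)) (Finset.mem_univ j)]
  simp only [Function.update_self, measure_univ, one_mul]
  rw [mul_comm]
  congr 1
  refine Finset.prod_congr rfl fun i hi => ?_
  rw [Function.update_of_ne (Finset.ne_of_mem_erase hi),
    Function.update_of_ne (Finset.ne_of_mem_erase hi)]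

section Cells

variable {E F : Type*} [MeasurableSpace E] [Fintype F] [DecidableEq F] [MeasurableSpace F]
  [MeasurableSingletonClass F]

/-- If the location to be replaced only depends on the cells, of a finite partition, that contain
the points, then the cells form a finite Markov chain, and a mixture of products of uniform
distributions on the cells is stationary. -/
lemma exists_stationary_of_cells (ρ : Measure E) [IsProbabilityMeasure ρ] {cell : E → F}
    (hcell : Measurable cell) (hpos : ∀ c, ρ (cell ⁻¹' {c}) ≠ 0) (j : (Fin m → F) → F → Fin m)
    (hT : Measurable fun p : (Fin m → E) × (E × E) =>
      Function.update p.1 (j (fun i => cell (p.1 i)) (cell p.2.1)) p.2.2) :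
    ∃ μ : Measure (Fin m → E), IsProbabilityMeasure μ ∧
      (μ.prod (ρ.prod ρ)).map (fun p : (Fin m → E) × (E × E) =>
        Function.update p.1 (j (fun i => cell (p.1 i)) (cell p.2.1)) p.2.2) = μ := by
  obtain ⟨e⟩ : Nonempty E := nonempty_of_isProbabilityMeasure ρ
  have : Nonempty F := ⟨cell e⟩
  set T := fun p : (Fin m → E) × (E × E) =>
      Function.update p.1 (j (fun i => cell (p.1 i)) (cell p.2.1)) p.2.2 with hTdef
  let q : F → ℝ≥0∞ := fun c => ρ (cell ⁻¹' {c})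
  let κ : F → Measure E := fun c => ProbabilityTheory.cond ρ (cell ⁻¹' {c})
  have hκ : ∀ c, IsProbabilityMeasure (κ c) := fun c =>
    ProbabilityTheory.cond_isProbabilityMeasure (hpos c)
  have hκc : ∀ c, ∀ᵐ y ∂(κ c), cell y = c := fun c =>
    ProbabilityTheory.ae_cond_mem (hcell (measurableSet_singleton c))
  have hρ : ρ = Measure.sum fun c => q c • κ c := by
    rw [Measure.sum_fintype]
    exact (ProbabilityTheory.sum_meas_smul_cond_fiber hcell ρ).symm
  have hq : ∑ c, q c = 1 := by
    have h := congrArg (fun ν : Measure E => ν Set.univ) hρ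
    simpa [Measure.sum_fintype] using h.symm
  let M : (Fin m → F) → Measure (Fin m → E) := fun v => Measure.pi fun i => κ (v i)
  have hM : ∀ v b c, ((M v).prod ((κ b).prod (κ c))).map T = M (Function.update v (j v b) c) := by
    intro v b c
    have hae : T =ᵐ[(M v).prod ((κ b).prod (κ c))]
        ((fun p : (Fin m → E) × E => Function.update p.1 (j v b) p.2) ∘ Prod.map id Prod.snd) := by
      have h1 : ∀ᵐ p ∂((M v).prod ((κ b).prod (κ c))), ∀ i, cell (p.1 i) = v i := by
        rw [ae_all_iff]
        intro i
        have h := (measurePreserving_eval (fun i => κ (v i)) i).quasiMeasurePreserving.ae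
          (hκc (v i))
        exact (measurePreserving_fst (μ := M v)
          (ν := (κ b).prod (κ c))).quasiMeasurePreserving.ae h
      have h2 : ∀ᵐ p ∂((M v).prod ((κ b).prod (κ c))), cell p.2.1 = b := by
        have h := (measurePreserving_fst (μ := κ b) (ν := κ c)).quasiMeasurePreserving.ae (hκc b)
        exact (measurePreserving_snd (μ := M v)
          (ν := (κ b).prod (κ c))).quasiMeasurePreserving.ae h
      filter_upwards [h1, h2] with p hp1 hp2
      have : (fun i => cell (p.1 i)) = v := funext hp1
      simp [hTdef, this, hp2]
    have hpres : MeasurePreserving (Prod.map id Prod.snd : (Fin m → E) × (E × E) → _)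
        ((M v).prod ((κ b).prod (κ c))) ((M v).prod (κ c)) :=
      (MeasurePreserving.id _).prod measurePreserving_snd
    rw [Measure.map_congr hae, ← Measure.map_map (measurable_update_fst _) hpres.measurable,
      hpres.map_eq, map_update_pi]
    congr 1
    funext i
    by_cases h : i = j v b
    · subst h; simp
    · simp [Function.update_of_ne h]
  have hstep : ∀ v, ((M v).prod (ρ.prod ρ)).map T =
      ∑ z : F × F, (q z.1 * q z.2) • M (Function.update v (j v z.1) z.2) := by
    intro v
    have h1 : (M v).prod (ρ.prod ρ) = Measure.sum fun z : F × F =>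
        (q z.1 * q z.2) • (M v).prod ((κ z.1).prod (κ z.2)) := by
      conv_lhs => rw [hρ]
      rw [Measure.prod_sum, Measure.prod_sum_right]
      congr 1
      funext z
      rw [Measure.prod_smul_left, Measure.prod_smul_right, Measure.prod_smul_right,
        Measure.prod_smul_right, smul_smul]
    rw [h1, Measure.map_sum hT.aemeasurable, Measure.sum_fintype]
    refine Finset.sum_congr rfl fun z _ => ?_
    rw [Measure.map_smul, hM]
  let P : (Fin m → F) → (Fin m → F) → ℝ≥0∞ := fun v v' =>
    ∑ z : F × F, if Function.update v (j v z.1) z.2 = v' then q z.1 * q z.2 else 0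
  obtain ⟨p, hp1, hp⟩ := exists_stationary_of_finite P fun v => by
    simp only [P]
    rw [Finset.sum_comm]
    simp only [Finset.sum_ite_eq, Finset.mem_univ, if_true]
    rw [Fintype.sum_prod_type]
    simp only [← Finset.mul_sum, hq, mul_one]
  refine ⟨Measure.sum fun v => p v • M v, ⟨?_⟩, ?_⟩
  · simp [Measure.sum_fintype, M, hp1]
  · rw [Measure.prod_sum_left, Measure.map_sum hT.aemeasurable]
    simp only [Measure.prod_smul_left, Measure.map_smul, hstep, Measure.sum_fintype]
    calc ∑ v, p v • ∑ z : F × F, (q z.1 * q z.2) • M (Function.update v (j v z.1) z.2)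
        = ∑ v, p v • ∑ v', P v v' • M v' := by
          refine Finset.sum_congr rfl fun v _ => ?_
          congr 1
          simp only [P, Finset.sum_smul]
          rw [Finset.sum_comm]
          simp [ite_smul]
      _ = ∑ v', (∑ v, p v * P v v') • M v' := by
          simp only [Finset.smul_sum, smul_smul, Finset.sum_smul]
          rw [Finset.sum_comm]
      _ = ∑ v', p v' • M v' := by simp only [hp]

end Cells

section Policy

variable {γ : ℕ → ℝ}

/-- A descent to a best-supplied child at each step never reaches an empty hypercube. -/
lemma exists_descent (x : Config d m) {k : ℕ} (hk : k ≤ L) (H : Fin d → ℕ)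
    (hH : 0 < supplyCount L k x H) :
    ∃ h : ℕ → Fin d → ℕ, h k = H ∧
      (∀ l < k, IsChild (h l) (h (l + 1)) ∧
        ∀ c, IsChild c (h (l + 1)) → supplyCount L l x c ≤ supplyCount L l x (h l)) ∧
      0 < supplyCount L 0 x (h 0) := by
  induction k generalizing H with
  | zero => exact ⟨fun _ => H, rfl, by simp, hH⟩
  | succ k ih =>
    have hne : (children H).Nonempty := by
      rw [← Finset.card_pos, card_children]; positivity
    obtain ⟨c, hc, hmax⟩ := Finset.exists_max_image (children H) (supplyCount L k x) hne
    have hcpos : 0 < supplyCount L k x c := by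
      by_contra h0
      have h1 : supplyCount L (k + 1) x H = ∑ c ∈ children H, supplyCount L k x c := by
        exact_mod_cast supplyCount_succ (show k < L by omega) x H
      rw [h1, Finset.sum_eq_zero fun c' hc' => by have := hmax c' hc'; omega] at hH
      exact lt_irrefl _ hH
    obtain ⟨h, h1, h2, h3⟩ := ih (by omega) c hcpos
    refine ⟨Function.update h (k + 1) H, by simp, fun l hl => ?_, ?_⟩
    · rw [Function.update_of_ne (by omega)]
      rcases Nat.lt_succ_iff_lt_or_eq.1 hl with hl | rfl
      · rw [Function.update_of_ne (by omega)]
        exact h2 l hl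
      · rw [Function.update_self, h1]
        exact ⟨isChild_iff.2 hc, fun c' hc' => hmax c' (isChild_iff.1 hc')⟩
    · rw [Function.update_of_ne (by omega)]
      exact h3

lemma exists_hierarchicalGreedy_choice (hγ : ValidThresholds d m L γ) (x : Config d m)
    (y : Cube d) : ∃ (j : Fin m) (h : ℕ → Fin d → ℕ),
      h (matchLevel L γ x y) = hypercube L (matchLevel L γ x y) y ∧
      (∀ l < matchLevel L γ x y, IsChild (h l) (h (l + 1)) ∧
        ∀ c, IsChild c (h (l + 1)) → supplyCount L l x c ≤ supplyCount L l x (h l)) ∧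
      hypercube L 0 (x j) = h 0 := by
  have hML := matchLevel_le (x := x) (y := y) hγ.top_lt
  have hpos : 0 < supplyCount L (matchLevel L γ x y) x
      (hypercube L (matchLevel L γ x y) y) := by
    have h1 := lt_supplyCount (x := x) (y := y) hML le_rfl
    have h2 := hγ.nonneg _ hML
    exact_mod_cast h2.trans_lt h1
  obtain ⟨h, h1, h2, h3⟩ := exists_descent x hML _ hpos
  obtain ⟨j, hj⟩ := Finset.card_pos.1 h3
  exact ⟨j, h, h1, h2, (Finset.mem_filter.1 hj).2⟩

/-- The leaf that contains a point. -/
def leaf (L : ℕ) (y : Cube d) : grid d L 0 := ⟨hypercube L 0 y, hypercube_mem_grid y⟩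

lemma measurable_leaf : Measurable (leaf (d := d) L) := measurable_hypercube.subtype_mk

lemma volume_leaf_ne_zero (c : grid d L 0) : (volume : Measure (Cube d)) (leaf L ⁻¹' {c}) ≠ 0 := by
  have : leaf L ⁻¹' {c} = {y : Cube d | hypercube L 0 y = c} := by
    ext y; simp [leaf, Subtype.ext_iff]
  rw [this, volume_hypercube_eq c.2]
  simp only [ne_eq, ENNReal.ofReal_eq_zero, not_le]
  positivity

lemma leaf_surjective : Function.Surjective (leaf (d := d) L) := fun c => by
  have h := nonempty_of_measure_ne_zero (volume_leaf_ne_zero c)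
  exact h

/-- There is a Hierarchical Greedy policy whose choice only depends on the leaves that contain the
supply units and the demand unit; it has a stationary distribution. -/
lemma exists_policy_isStationary (hγ : ValidThresholds d m L γ) :
    ∃ π : Policy d m, IsHierarchicalGreedy L γ π ∧ ∃ μ, IsStationary π μ := by
  classical
  choose pt hpt using leaf_surjective (d := d) (L := L)
  choose j₀ hj₀ using exists_hierarchicalGreedy_choice (L := L) (d := d) (m := m) hγ
  let j : (Fin m → grid d L 0) → grid d L 0 → Fin m := fun v b => j₀ (fun i => pt (v i)) (pt b)
  let π : Policy d m :=
    { choose := fun x y => j (fun i => leaf L (x i)) (leaf L y)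
      measurable_choose := by
        have h1 : Measurable fun p : Config d m × Cube d =>
            ((fun i => leaf L (p.1 i)), leaf L p.2) := by
          refine Measurable.prodMk (measurable_pi_lambda _ fun i => ?_)
            (measurable_leaf.comp measurable_snd)
          exact measurable_leaf.comp ((measurable_pi_apply i).comp measurable_fst)
        have h2 : Measurable fun q : (Fin m → grid d L 0) × grid d L 0 => j q.1 q.2 :=
          Measurable.of_discrete
        exact h2.comp h1 }
  have hpt' : ∀ y : Cube d, hypercube L 0 (pt (leaf L y)) = hypercube L 0 y := fun y =>
    congrArg Subtype.val (hpt (leaf L y))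
  refine ⟨π, fun x y => ?_, ?_⟩
  · obtain ⟨h, h1, h2, h3⟩ := hj₀ (fun i => pt (leaf L (x i))) (pt (leaf L y))
    have hx : cells L 0 (fun i => pt (leaf L (x i))) = cells L 0 x :=
      funext fun i => hpt' (x i)
    have hML := matchLevel_le (x := x) (y := y) hγ.top_lt
    rw [matchLevel_congr hx (hpt' y)] at h1 h2
    rw [hypercube_congr (Nat.zero_le _) hML (hpt' y)] at h1
    refine ⟨h, h1, fun l hl => ?_, ?_⟩
    · have h4 := h2 l hl
      rwa [supplyCount_congr (cells_congr (by omega) hx)] at h4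
    · rw [← h3, hpt']
  · obtain ⟨μ, hμ, hst⟩ := exists_stationary_of_cells (volume : Measure (Cube d))
      (measurable_leaf (L := L)) volume_leaf_ne_zero j (measurable_nextConfig π)
    exact ⟨μ, hμ, hst⟩

end Policy

/-! ### The choice of the thresholds -/

/-- The minimum supplies with relative increments `δ`: the level-`l` hypercubes have
`2 ^ (l * d)` leaves, and the minimum supply per leaf grows by `δ l` from level `l` to `l + 1`. -/
def threshold (d : ℕ) (δ : ℕ → ℝ) (l : ℕ) : ℝ := 2 ^ (l * d) * ∑ k ∈ Finset.range l, δ k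

lemma threshold_succ_div_sub (δ : ℕ → ℝ) (l : ℕ) :
    threshold d δ (l + 1) / 2 ^ d - threshold d δ l = 2 ^ (l * d) * δ l := by
  rw [threshold, threshold, Finset.sum_range_succ, add_mul, one_mul, pow_add]
  field_simp
  ring

/-- The requirements on the height `L` and the increments `δ` under which Hierarchical Greedy with
`m` supply units has a cost of order `(1 + R) / 2 ^ L`. The three sums bound the effects of the
steady fluctuations, of the discreteness of evenly spread locations, and of accumulations on the
upper faces of the unit cube. -/
structure GoodIncrements (d m L : ℕ) (δ : ℕ → ℝ) (R : ℝ) : Prop where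
  pos : ∀ l, 0 < δ l
  sum_lt : ∑ l ∈ Finset.range L, δ l < 1
  pow_le : 2 ^ (L * d) ≤ m
  rpow_le : (m : ℝ) ^ (1 / (d : ℝ)) ≤ 2 * 2 ^ L
  sum_steady_le : ∑ l ∈ Finset.range L, (2 : ℝ) ^ l * (1 / (2 ^ (l * d) * δ l)) ≤ R
  sum_sq_le : ∑ l ∈ Finset.range L, (2 : ℝ) ^ l * (1 / (2 ^ l * δ l)) ^ 2 ≤ R
  sum_face_le : ∑ l ∈ Finset.range L, (2 : ℝ) ^ l * (1 / (2 ^ L * δ l)) ≤ R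

section Good
variable {δ : ℕ → ℝ} {R : ℝ}

lemma GoodIncrements.nonneg (h : GoodIncrements d m L δ R) : 0 ≤ R := by
  refine le_trans (Finset.sum_nonneg fun l _ => ?_) h.sum_steady_le
  have := h.pos l
  positivity

lemma GoodIncrements.validThresholds (h : GoodIncrements d m L δ R) :
    ValidThresholds d m L (threshold d δ) where
  nonneg l _ := mul_nonneg (by positivity) (Finset.sum_nonneg fun k _ => (h.pos k).le)
  le_parent l _ := by
    have h1 := threshold_succ_div_sub (d := d) δ l
    have h2 : 0 ≤ 2 ^ (l * d) * δ l := mul_nonneg (by positivity) (h.pos l).le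
    rw [inv_mul_eq_div]
    linarith
  top_lt := by
    have h1 : ((2 : ℝ) ^ (L * d)) ≤ m := by exact_mod_cast h.pow_le
    refine lt_of_lt_of_le ?_ h1
    rw [threshold]
    exact mul_lt_of_lt_one_right (by positivity) h.sum_lt

variable {π : Policy d m}

/-- Bounds on the expected numbers of matches at each level give a bound on the average cost. -/
lemma IsHierarchicalGreedy.avgCost_le {γ : ℕ → ℝ} (hπ : IsHierarchicalGreedy L γ π)
    (htop : γ L < m) (x : Config d m) {N : ℕ} (hN : 0 < N) {b : ℕ → ℝ}
    (hb : ∀ l < L, ∑ t ∈ Finset.range N, ((lawAt π x t).prod volume).real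
      {p : Config d m × Cube d | matchLevel L γ p.1 p.2 = l + 1} ≤ N * b l) :
    avgCost π x N ≤ Real.sqrt d / 2 ^ L * (1 + 2 * ∑ l ∈ Finset.range L, 2 ^ l * b l) := by
  have hN' : (0 : ℝ) < N := by exact_mod_cast hN
  rw [avgCost_eq, div_le_iff₀ hN']
  refine (Finset.sum_le_sum fun t _ => hπ.steadyCost_le htop (lawAt π x t)).trans ?_
  rw [← Finset.mul_sum, Finset.sum_add_distrib, Finset.sum_comm, mul_assoc]
  refine mul_le_mul_of_nonneg_left ?_ (by positivity)
  rw [add_mul, one_mul, Finset.sum_const, Finset.card_range, nsmul_eq_mul, mul_one, Finset.mul_sum,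
    Finset.sum_mul]
  refine add_le_add le_rfl (Finset.sum_le_sum fun l hl => ?_)
  rw [← Finset.mul_sum]
  calc _ ≤ (2 : ℝ) ^ (l + 1) * (N * b l) :=
        mul_le_mul_of_nonneg_left (hb l (Finset.mem_range.1 hl)) (by positivity)
    _ = _ := by ring

/-- Half the gap between the thresholds is an admissible parameter of the potential. -/
lemma GoodIncrements.gap (h : GoodIncrements d m L δ R) (l : ℕ) :
    0 < 2 ^ (l * d) * δ l / 2 ∧
      2 * (2 ^ (l * d) * δ l / 2) ≤ threshold d δ (l + 1) / 2 ^ d - threshold d δ l := by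
  have := h.pos l
  refine ⟨by positivity, ?_⟩
  rw [threshold_succ_div_sub]
  linarith

lemma GoodIncrements.steadyCost_le (h : GoodIncrements d m L δ R)
    (hπ : IsHierarchicalGreedy L (threshold d δ) π) {μ : Measure (Config d m)}
    (hμ : IsStationary π μ) : steadyCost π μ ≤ Real.sqrt d / 2 ^ L * (1 + 4 * R) := by
  have hp := hμ.1
  have htop := h.validThresholds.top_lt
  refine (hπ.steadyCost_le htop μ).trans (mul_le_mul_of_nonneg_left ?_ (by positivity))
  have h1 : ∀ l ∈ Finset.range L, (2 : ℝ) ^ (l + 1) * (μ.prod volume).real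
      {p : Config d m × Cube d | matchLevel L (threshold d δ) p.1 p.2 = l + 1} ≤
      4 * (2 ^ l * (1 / (2 ^ (l * d) * δ l))) := by
    intro l hl
    have h2 := hπ.matchLevel_prob_le_of_isStationary htop (Finset.mem_range.1 hl) (h.gap l).1
      (h.gap l).2 hμ
    have h3 := h.pos l
    calc _ ≤ (2 : ℝ) ^ (l + 1) * (1 / (2 ^ (l * d) * δ l / 2)) :=
          mul_le_mul_of_nonneg_left h2 (by positivity)
      _ = _ := by field_simp; ring
  have h2 := Finset.sum_le_sum h1
  rw [← Finset.mul_sum] at h2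
  linarith [h.sum_steady_le]

lemma GoodIncrements.avgCost_le (h : GoodIncrements d m L δ R)
    (hπ : IsHierarchicalGreedy L (threshold d δ) π) (x : Config d m) {N : ℕ} (hN : 0 < N)
    (hNL : 2 ^ L * m ≤ N) : avgCost π x N ≤ Real.sqrt d / 2 ^ L * (3 + 4 * R) := by
  have hN' : (0 : ℝ) < N := by exact_mod_cast hN
  have htop := h.validThresholds.top_lt
  refine (hπ.avgCost_le htop x hN (b := fun l => m / N + 2 * (1 / (2 ^ (l * d) * δ l)))
    fun l hl => ?_).trans (mul_le_mul_of_nonneg_left ?_ (by positivity))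
  · refine (hπ.sum_matchLevel_prob_le htop hl (h.gap l).1 (h.gap l).2 x N).trans (le_of_eq ?_)
    have h3 := h.pos l
    field_simp
  · have h1 : ∑ l ∈ Finset.range L, (2 : ℝ) ^ l * (m / N + 2 * (1 / (2 ^ (l * d) * δ l))) =
        (∑ l ∈ Finset.range L, (2 : ℝ) ^ l) * (m / N) +
          2 * ∑ l ∈ Finset.range L, (2 : ℝ) ^ l * (1 / (2 ^ (l * d) * δ l)) := by
      rw [Finset.sum_mul, Finset.mul_sum, ← Finset.sum_add_distrib]
      exact Finset.sum_congr rfl fun l _ => by ring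
    have h2 : (∑ l ∈ Finset.range L, (2 : ℝ) ^ l) * (m / N) ≤ 1 := by
      have h3 : (∑ l ∈ Finset.range L, (2 : ℝ) ^ l) ≤ 2 ^ L := by
        rw [geom_sum_eq (by norm_num)]; norm_num
      have h4 : (2 : ℝ) ^ L * m ≤ N := by exact_mod_cast hNL
      calc _ ≤ (2 : ℝ) ^ L * (m / N) := mul_le_mul_of_nonneg_right h3 (by positivity)
        _ ≤ 1 := by rw [← mul_div_assoc, div_le_one hN']; exact h4
    rw [h1]
    linarith [h.sum_steady_le]

lemma GoodIncrements.avgCost_le_of_evenlySpread (h : GoodIncrements d m L δ R) (hd : 1 ≤ d)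
    (hπ : IsHierarchicalGreedy L (threshold d δ) π) {K : ℝ} (hK : 0 ≤ K) {x : Config d m}
    (hx : EvenlySpread K x) {N : ℕ} (hN : 0 < N) :
    avgCost π x N ≤ Real.sqrt d / 2 ^ L *
      (1 + 2 * ((2 + (8 * K * 5 ^ (d - 1)) ^ 2 + 4 * K * 3 ^ (d - 1) * 2 ^ d) * R)) := by
  have htop := h.validThresholds.top_lt
  set A := 8 * K * 5 ^ (d - 1) with hA
  set B := 4 * K * 3 ^ (d - 1) * 2 ^ d with hB
  have hB0 : 0 ≤ B := by positivity
  refine (hπ.avgCost_le htop x hN (b := fun l => 2 * (1 / (2 ^ (l * d) * δ l)) +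
    A ^ 2 * (1 / (2 ^ l * δ l)) ^ 2 + B * (1 / (2 ^ L * δ l)))
    fun l hl => ?_).trans (mul_le_mul_of_nonneg_left ?_ (by positivity))
  · have hδ := h.pos l
    have hld : (2 : ℝ) ^ (l * d) = 2 ^ l * (2 ^ l) ^ (d - 1) := by
      rw [pow_mul, ← pow_succ', Nat.sub_add_cancel hd]
    -- If the condition fails, then `1 ≤ A / (2 ^ l * δ l)`, so the trivial bound `1` on the
    -- probability is at most the square of this, which is still summable against `2 ^ l`.
    by_cases hKa : 2 * (K * (5 * 2 ^ l) ^ (d - 1)) ≤ 2 ^ (l * d) * δ l / 2 / 2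
    · refine (hπ.sum_matchLevel_prob_le_of_evenlySpread htop hl (h.gap l).1 (h.gap l).2 hK hx
        h.rpow_le hKa N).trans (mul_le_mul_of_nonneg_left ?_ (Nat.cast_nonneg _))
      have h1 : 1 / (2 ^ (l * d) * δ l / 2) = 2 * (1 / (2 ^ (l * d) * δ l)) := by field_simp
      have h2 : 2 / (2 ^ (l * d) * δ l / 2) * (K * (3 * 2 ^ L) ^ (d - 1)) *
          (2 ^ ((L - (l + 1)) * d))⁻¹ = B * (1 / (2 ^ L * δ l)) := by
        have h3 : (2 : ℝ) ^ (l * d) * 2 ^ ((L - (l + 1)) * d) * 2 ^ d =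
            2 ^ L * (2 ^ L) ^ (d - 1) := by
          rw [← pow_succ', Nat.sub_add_cancel hd, ← pow_mul, ← pow_add, ← pow_add]
          congr 1
          have : L = l + (L - (l + 1)) + 1 := by omega
          conv_rhs => rw [this]
          ring
        rw [hB, mul_pow]
        have h4 : (2 : ℝ) / (2 ^ (l * d) * δ l / 2) * (K * (3 ^ (d - 1) * (2 ^ L) ^ (d - 1))) *
            (2 ^ ((L - (l + 1)) * d))⁻¹ = 4 * K * 3 ^ (d - 1) * 2 ^ d * (2 ^ L) ^ (d - 1) /
              (2 ^ (l * d) * 2 ^ ((L - (l + 1)) * d) * 2 ^ d * δ l) := by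
          field_simp; ring
        rw [h4, h3]
        field_simp
      rw [h1, h2]
      have : 0 ≤ A ^ 2 * (1 / (2 ^ l * δ l)) ^ 2 := by positivity
      linarith
    · have h1 : 1 ≤ A * (1 / (2 ^ l * δ l)) := by
        push Not at hKa
        rw [mul_one_div, le_div_iff₀ (by positivity), one_mul, hA]
        rw [hld, mul_pow] at hKa
        have h3 : (0 : ℝ) < (2 ^ l) ^ (d - 1) := by positivity
        refine le_of_mul_le_mul_left ?_ h3
        nlinarith
      have h2 : (1 : ℝ) ≤ A ^ 2 * (1 / (2 ^ l * δ l)) ^ 2 := by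
        rw [← mul_pow]; exact one_le_pow₀ h1
      have h3 : ∑ t ∈ Finset.range N, ((lawAt π x t).prod volume).real
          {p : Config d m × Cube d | matchLevel L (threshold d δ) p.1 p.2 = l + 1} ≤ N * 1 := by
        refine (Finset.sum_le_sum fun t _ => measureReal_le_one).trans (le_of_eq ?_)
        simp
      refine h3.trans (mul_le_mul_of_nonneg_left ?_ (Nat.cast_nonneg _))
      have h4 : 0 ≤ 2 * (1 / (2 ^ (l * d) * δ l)) := by positivity
      have h5 : 0 ≤ B * (1 / (2 ^ L * δ l)) := by positivity
      linarith
  · have h1 : ∑ l ∈ Finset.range L, (2 : ℝ) ^ l * (2 * (1 / (2 ^ (l * d) * δ l)) +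
        A ^ 2 * (1 / (2 ^ l * δ l)) ^ 2 + B * (1 / (2 ^ L * δ l))) =
        2 * ∑ l ∈ Finset.range L, (2 : ℝ) ^ l * (1 / (2 ^ (l * d) * δ l)) +
        A ^ 2 * ∑ l ∈ Finset.range L, (2 : ℝ) ^ l * (1 / (2 ^ l * δ l)) ^ 2 +
        B * ∑ l ∈ Finset.range L, (2 : ℝ) ^ l * (1 / (2 ^ L * δ l)) := by
      rw [Finset.mul_sum, Finset.mul_sum, Finset.mul_sum, ← Finset.sum_add_distrib,
        ← Finset.sum_add_distrib]
      exact Finset.sum_congr rfl fun l _ => by ring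
    rw [h1]
    have h2 := mul_le_mul_of_nonneg_left h.sum_sq_le (sq_nonneg A)
    have h3 := mul_le_mul_of_nonneg_left h.sum_face_le hB0
    linarith [h.sum_steady_le]

end Good

lemma EvenlySpread.mono {K K' : ℝ} (hK : K ≤ K') {x : Config d m} (hx : EvenlySpread K x) :
    EvenlySpread K' x := fun a s hs h =>
  (hx a s hs h).trans (mul_le_mul_of_nonneg_right hK (by positivity))

/-- Good increments give the claimed rate, with constants that do not depend on `m`. -/
lemma hgAchieves_of_goodIncrements (hd : 1 ≤ d) {L : ℕ → ℕ} {δ : ℕ → ℕ → ℝ} {R rate : ℕ → ℝ}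
    {horizon : ℕ → ℝ} (h : ∀ m ≥ 2, GoodIncrements d m (L m) (δ m) (R m)) {c : ℝ}
    (hrate : ∀ m ≥ 2, (1 + R m) / 2 ^ L m ≤ c * rate m) (hrate0 : ∀ m, 0 ≤ rate m)
    (hhor : ∀ m ≥ 2, 2 ^ L m * (m : ℝ) ≤ horizon m) :
    HGAchieves d L (fun m => threshold d (δ m)) rate horizon := by
  have key : ∀ A : ℝ, 4 ≤ A → ∀ m ≥ 2, ∀ r : ℝ,
      r ≤ Real.sqrt d / 2 ^ L m * (3 + A * R m) →
      r ≤ max 1 (Real.sqrt d * A * c) * rate m := by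
    intro A hA m hm r hr
    have hR := (h m hm).nonneg
    calc r ≤ Real.sqrt d / 2 ^ L m * (3 + A * R m) := hr
      _ ≤ Real.sqrt d / 2 ^ L m * (A * (1 + R m)) :=
        mul_le_mul_of_nonneg_left (by linarith) (by positivity)
      _ = Real.sqrt d * A * ((1 + R m) / 2 ^ L m) := by ring
      _ ≤ Real.sqrt d * A * (c * rate m) :=
        mul_le_mul_of_nonneg_left (hrate m hm) (by positivity)
      _ = Real.sqrt d * A * c * rate m := by ring
      _ ≤ _ := mul_le_mul_of_nonneg_right (le_max_right _ _) (hrate0 m)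
  refine ⟨fun m hm => ⟨(h m hm).validThresholds,
    exists_policy_isStationary (h m hm).validThresholds⟩, ⟨max 1 (Real.sqrt d * 4 * c),
      lt_max_of_lt_left one_pos, fun m hm π hπ => ⟨fun μ hμ => ?_, fun x N hN => ?_⟩⟩, fun K => ?_⟩
  · refine key 4 le_rfl m hm _ (((h m hm).steadyCost_le hπ hμ).trans ?_)
    exact mul_le_mul_of_nonneg_left (by linarith) (by positivity)
  · have hpos : (0 : ℝ) < 2 ^ L m * (m : ℝ) := by positivity
    have h1 : 2 ^ L m * (m : ℝ) ≤ N := by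
      refine le_trans ((hhor m hm).trans ?_) hN
      exact le_mul_of_one_le_left (hpos.le.trans (hhor m hm)) (le_max_left _ _)
    have hN0 : 0 < N := by exact_mod_cast hpos.trans_le h1
    exact key 4 le_rfl m hm _ ((h m hm).avgCost_le hπ x hN0 (by exact_mod_cast h1))
  · set B := (8 * |K| * 5 ^ (d - 1)) ^ 2 + 4 * |K| * 3 ^ (d - 1) * 2 ^ d with hB
    have hB0 : 0 ≤ B := by positivity
    refine ⟨max 1 (Real.sqrt d * (4 + 2 * B) * c), lt_max_of_lt_left one_pos,
      fun m hm π hπ x hx N hN => ?_⟩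
    refine key (4 + 2 * B) (by linarith) m hm _ (((h m hm).avgCost_le_of_evenlySpread hd hπ
      (abs_nonneg K) (hx.mono (le_abs_self K)) hN).trans ?_)
    refine mul_le_mul_of_nonneg_left ?_ (by positivity)
    have : (2 + (8 * |K| * 5 ^ (d - 1)) ^ 2 + 4 * |K| * 3 ^ (d - 1) * 2 ^ d) = 2 + B := by
      rw [hB]; ring
    rw [this]
    linarith

/-- The height: the largest one for which there is at least one unit per leaf on average. -/
def height (d m : ℕ) : ℕ := Nat.log (2 ^ d) m

lemma pow_height_le (d : ℕ) (hm : 2 ≤ m) : 2 ^ (height d m * d) ≤ m := by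
  rw [mul_comm, pow_mul]
  exact Nat.pow_log_le_self _ (by omega)

lemma pow_height_le_rpow (hd : 1 ≤ d) (hm : 2 ≤ m) :
    (2 : ℝ) ^ height d m ≤ (m : ℝ) ^ (1 / (d : ℝ)) := by
  have h : ((2 : ℝ) ^ height d m) ^ d ≤ m := by
    rw [← pow_mul]; exact_mod_cast pow_height_le d hm
  have h2 := Real.rpow_le_rpow (by positivity) h (show 0 ≤ 1 / (d : ℝ) by positivity)
  rwa [one_div, Real.pow_rpow_inv_natCast (by positivity) (by omega), ← one_div] at h2

lemma rpow_le_two_mul_pow_height (hd : 1 ≤ d) (m : ℕ) :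
    (m : ℝ) ^ (1 / (d : ℝ)) ≤ 2 * 2 ^ height d m := by
  have h : (m : ℝ) ≤ ((2 : ℝ) * 2 ^ height d m) ^ d := by
    have h1 : 1 < 2 ^ d := Nat.one_lt_two_pow (by omega)
    have h2 := Nat.lt_pow_succ_log_self h1 m
    rw [← pow_succ', ← pow_mul, mul_comm, pow_mul]
    exact_mod_cast h2.le
  have h2 := Real.rpow_le_rpow (by positivity) h (show 0 ≤ 1 / (d : ℝ) by positivity)
  rwa [one_div, Real.pow_rpow_inv_natCast (by positivity) (by omega), ← one_div] at h2

lemma sum_geometric_le {r : ℝ} (h0 : 0 ≤ r) (h1 : r < 1) (n : ℕ) :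
    ∑ l ∈ Finset.range n, r ^ l ≤ (1 - r)⁻¹ := by
  rw [← tsum_geometric_of_lt_one h0 h1]
  exact (summable_geometric_of_lt_one h0 h1).sum_le_tsum _ fun _ _ => pow_nonneg h0 _

/-- The relative increments for `d ≥ 2`. Their decay in `l` leaves room for all levels; that they
are bounded below in terms of `L - 1 - l` controls the effect of units on the upper faces. -/
def increment (L l : ℕ) : ℝ := ((3 / 4) ^ l + (3 / 4) ^ (L - 1 - l)) / 8

lemma goodIncrements_increment (hd : 2 ≤ d) (hm : 2 ≤ m) :
    GoodIncrements d m (height d m) (increment (height d m)) 576 := by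
  set L := height d m with hL
  have hpos : ∀ l, 0 < increment L l := fun l => by unfold increment; positivity
  have hge1 : ∀ l, (3 / 4 : ℝ) ^ l / 8 ≤ increment L l := fun l => by
    unfold increment
    have : (0 : ℝ) ≤ (3 / 4) ^ (L - 1 - l) := by positivity
    linarith
  have hge2 : ∀ l, (3 / 4 : ℝ) ^ (L - 1 - l) / 8 ≤ increment L l := fun l => by
    unfold increment
    have : (0 : ℝ) ≤ (3 / 4) ^ l := by positivity
    linarith
  refine ⟨hpos, ?_, pow_height_le d hm, rpow_le_two_mul_pow_height (by omega) m, ?_, ?_, ?_⟩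
  · unfold increment
    rw [← Finset.sum_div, Finset.sum_add_distrib,
      Finset.sum_range_reflect (fun l => (3 / 4 : ℝ) ^ l) L, geom_sum_eq (by norm_num),
      show ((3 / 4 : ℝ) ^ L - 1) / (3 / 4 - 1) = 4 * (1 - (3 / 4) ^ L) by ring]
    have : (0 : ℝ) < (3 / 4) ^ L := by positivity
    linarith
  · calc _ ≤ ∑ l ∈ Finset.range L, 8 * (2 / 3 : ℝ) ^ l := by
          refine Finset.sum_le_sum fun l _ => ?_
          have h4 : (4 : ℝ) ^ l ≤ 2 ^ (l * d) := by
            rw [mul_comm, pow_mul]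
            refine pow_le_pow_left₀ (by norm_num) ?_ l
            calc (4 : ℝ) = 2 ^ 2 := by norm_num
              _ ≤ 2 ^ d := pow_le_pow_right₀ (by norm_num) hd
          calc (2 : ℝ) ^ l * (1 / (2 ^ (l * d) * increment L l))
              ≤ 2 ^ l * (1 / (4 ^ l * ((3 / 4) ^ l / 8))) := by
                gcongr
                exact hge1 l
            _ = 8 * (2 / 3 : ℝ) ^ l := by
                have : (4 : ℝ) ^ l * ((3 / 4) ^ l / 8) = 3 ^ l / 8 := by
                  rw [← mul_div_assoc, ← mul_pow]; norm_num
                rw [this, div_pow]; field_simp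
      _ ≤ 576 := by
          rw [← Finset.mul_sum]
          have := sum_geometric_le (r := 2 / 3) (by norm_num) (by norm_num) L
          norm_num at this ⊢
          linarith
  · calc _ ≤ ∑ l ∈ Finset.range L, 64 * (8 / 9 : ℝ) ^ l := by
          refine Finset.sum_le_sum fun l _ => ?_
          calc (2 : ℝ) ^ l * (1 / (2 ^ l * increment L l)) ^ 2
              ≤ 2 ^ l * (1 / (2 ^ l * ((3 / 4) ^ l / 8))) ^ 2 := by
                have := hpos l
                gcongr
                exact hge1 l
            _ = 64 * (8 / 9 : ℝ) ^ l := by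
                have h1 : (8 / 9 : ℝ) ^ l = 2 ^ l * ((2 / 3) ^ l) ^ 2 := by
                  rw [← pow_mul, mul_comm l 2, pow_mul, ← mul_pow]; norm_num
                have h2 : (2 : ℝ) ^ l * ((3 / 4) ^ l / 8) = (3 / 2) ^ l / 8 := by
                  rw [← mul_div_assoc, ← mul_pow]; norm_num
                have h3 : (3 / 2 : ℝ) ^ l * (2 / 3) ^ l = 1 := by rw [← mul_pow]; norm_num
                have h4 : 1 / ((3 / 2 : ℝ) ^ l / 8) = 8 * (2 / 3) ^ l := by
                  rw [div_eq_iff (by positivity)]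
                  linear_combination -h3
                rw [h1, h2, h4]; ring
      _ ≤ 576 := by
          rw [← Finset.mul_sum]
          have := sum_geometric_le (r := 8 / 9) (by norm_num) (by norm_num) L
          norm_num at this ⊢
          linarith
  · calc _ ≤ ∑ l ∈ Finset.range L, 4 * (2 / 3 : ℝ) ^ (L - 1 - l) := by
          refine Finset.sum_le_sum fun l hl => ?_
          have hl' : l < L := Finset.mem_range.1 hl
          calc (2 : ℝ) ^ l * (1 / (2 ^ L * increment L l))
              ≤ 2 ^ l * (1 / (2 ^ L * ((3 / 4) ^ (L - 1 - l) / 8))) := by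
                gcongr
                exact hge2 l
            _ = 4 * (2 / 3 : ℝ) ^ (L - 1 - l) := by
                have h1 : (2 : ℝ) ^ L = 2 ^ l * 2 ^ (L - 1 - l) * 2 := by
                  rw [← pow_add, ← pow_succ]; congr 1; omega
                have h2 : (2 / 3 : ℝ) ^ (L - 1 - l) * 2 ^ (L - 1 - l) * (3 / 4) ^ (L - 1 - l) =
                    1 := by
                  rw [← mul_pow, ← mul_pow]; norm_num
                rw [h1, mul_one_div, div_eq_iff (by positivity)]
                linear_combination (-(2 : ℝ) ^ l) * h2
      _ ≤ 576 := by
          rw [← Finset.mul_sum, Finset.sum_range_reflect (fun l => (2 / 3 : ℝ) ^ l) L]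
          have := sum_geometric_le (r := 2 / 3) (by norm_num) (by norm_num) L
          norm_num at this ⊢
          linarith

/-- In dimension one, equal increments are used: each of the `L` levels contributes order `L` to
the sum over the levels. -/
lemma goodIncrements_one (hm : 2 ≤ m) :
    GoodIncrements 1 m (height 1 m) (fun _ => 1 / (height 1 m + 1 : ℝ))
      (2 * (height 1 m + 1 : ℝ) ^ 2) := by
  set L := height 1 m with hL
  have hL1 : (0 : ℝ) < L + 1 := by positivity
  have hL0 : (0 : ℝ) ≤ L := Nat.cast_nonneg _
  refine ⟨fun l => by positivity, ?_, pow_height_le 1 hm, rpow_le_two_mul_pow_height le_rfl m,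
    ?_, ?_, ?_⟩
  · rw [Finset.sum_const, Finset.card_range, nsmul_eq_mul, mul_one_div, div_lt_one hL1]
    linarith
  · have : ∀ l ∈ Finset.range L, (2 : ℝ) ^ l * (1 / (2 ^ (l * 1) * (1 / (L + 1 : ℝ)))) = L + 1 :=
      fun l _ => by rw [mul_one]; field_simp
    rw [Finset.sum_congr rfl this, Finset.sum_const, Finset.card_range, nsmul_eq_mul]
    nlinarith
  · have : ∀ l ∈ Finset.range L, (2 : ℝ) ^ l * (1 / (2 ^ l * (1 / (L + 1 : ℝ)))) ^ 2 =
        (L + 1) ^ 2 * (1 / 2) ^ l := fun l _ => by rw [div_pow 1 2, one_pow]; field_simp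
    rw [Finset.sum_congr rfl this, ← Finset.mul_sum]
    have h := sum_geometric_le (r := 1 / 2) (by norm_num) (by norm_num) L
    have h2 := mul_le_mul_of_nonneg_left h (sq_nonneg (L + 1 : ℝ))
    norm_num at h2 ⊢
    linarith
  · have : ∀ l ∈ Finset.range L, (2 : ℝ) ^ l * (1 / (2 ^ L * (1 / (L + 1 : ℝ)))) =
        (L + 1) / 2 ^ L * 2 ^ l := fun l _ => by field_simp
    rw [Finset.sum_congr rfl this, ← Finset.mul_sum, geom_sum_eq (by norm_num)]
    have h1 : (L + 1 : ℝ) / 2 ^ L * ((2 ^ L - 1) / (2 - 1)) ≤ L + 1 := by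
      rw [div_mul_eq_mul_div, div_le_iff₀ (by positivity)]
      norm_num
      nlinarith
    nlinarith

lemma hgAchieves_of_two_le (hd : 2 ≤ d) :
    HGAchieves d (height d) (fun m => threshold d (increment (height d m)))
      (fun m => 1 / (m : ℝ) ^ (1 / (d : ℝ)))
      (fun m => (m : ℝ) ^ ((1.01 : ℝ) + 1 / (d : ℝ))) := by
  refine hgAchieves_of_goodIncrements (by omega) (R := fun _ => 576) (c := 1154)
    (fun m hm => goodIncrements_increment hd hm) (fun m hm => ?_) (fun m => by positivity)
    (fun m hm => ?_)
  · have hm0 : (0 : ℝ) < m := by positivity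
    have hM : (0 : ℝ) < (m : ℝ) ^ (1 / (d : ℝ)) := by positivity
    have h := rpow_le_two_mul_pow_height (d := d) (by omega) m
    rw [mul_one_div, div_le_div_iff₀ (by positivity) hM]
    linarith
  · have hm1 : (1 : ℝ) ≤ m := by exact_mod_cast (show 1 ≤ m by omega)
    calc (2 : ℝ) ^ height d m * (m : ℝ) ≤ (m : ℝ) ^ (1 / (d : ℝ)) * m :=
          mul_le_mul_of_nonneg_right (pow_height_le_rpow (by omega) hm) (by positivity)
      _ = (m : ℝ) ^ (1 / (d : ℝ) + 1) := by
          rw [Real.rpow_add (by linarith), Real.rpow_one]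
      _ ≤ _ := Real.rpow_le_rpow_of_exponent_le hm1 (by linarith)

lemma hgAchieves_one :
    HGAchieves 1 (height 1) (fun m => threshold 1 fun _ => 1 / (height 1 m + 1 : ℝ))
      (fun m => (Real.log m) ^ 2 / (m : ℝ)) (fun m => (m : ℝ) ^ 3) := by
  refine hgAchieves_of_goodIncrements le_rfl (δ := fun m _ => 1 / (height 1 m + 1 : ℝ))
    (R := fun m => 2 * (height 1 m + 1 : ℝ) ^ 2) (c := 96)
    (fun m hm => goodIncrements_one hm) (fun m hm => ?_) (fun m => by positivity)
    (fun m hm => ?_)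
  · have hm2 : (2 : ℝ) ≤ m := by exact_mod_cast hm
    have hle := pow_height_le_rpow (d := 1) le_rfl hm
    have hge := rpow_le_two_mul_pow_height (d := 1) le_rfl m
    simp only [Nat.cast_one, div_one, Real.rpow_one] at hle hge
    have h2 : (1 / 2 : ℝ) ≤ Real.log 2 := by linarith [Real.log_two_gt_d9]
    have hlog2 : (1 / 2 : ℝ) ≤ Real.log m := h2.trans (Real.log_le_log (by norm_num) hm2)
    have hlog : (height 1 m : ℝ) * Real.log 2 ≤ Real.log m := by
      rw [← Real.log_pow]
      exact Real.log_le_log (by positivity) hle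
    have hL0 : (0 : ℝ) ≤ height 1 m := Nat.cast_nonneg _
    have hL : (height 1 m + 1 : ℝ) ≤ 4 * Real.log m := by nlinarith
    have hsq : (height 1 m + 1 : ℝ) ^ 2 ≤ (4 * Real.log m) ^ 2 :=
      pow_le_pow_left₀ (by positivity) hL 2
    rw [← mul_div_assoc, div_le_div_iff₀ (by positivity) (by linarith)]
    have h3 : 1 + 2 * (height 1 m + 1 : ℝ) ^ 2 ≤ 48 * Real.log m ^ 2 := by nlinarith
    calc (1 + 2 * (height 1 m + 1 : ℝ) ^ 2) * m
        ≤ 48 * Real.log m ^ 2 * (2 * 2 ^ height 1 m) :=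
          mul_le_mul h3 hge (by positivity) (by positivity)
      _ = _ := by ring
  · have hm1 : (1 : ℝ) ≤ m := by exact_mod_cast (show 1 ≤ m by omega)
    have hle := pow_height_le_rpow (d := 1) le_rfl hm
    simp only [Nat.cast_one, div_one, Real.rpow_one] at hle
    calc (2 : ℝ) ^ height 1 m * (m : ℝ) ≤ m * m := mul_le_mul_of_nonneg_right hle (by positivity)
      _ = (m : ℝ) ^ 2 := by ring
      _ ≤ (m : ℝ) ^ 3 := pow_le_pow_right₀ hm1 (by norm_num)

end

end SpatialMatching

theorem theorem4 :
    (∀ d : ℕ, 2 ≤ d → ∃ (L : ℕ → ℕ) (γ : ℕ → ℕ → ℝ),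
      SpatialMatching.HGAchieves d L γ
        (fun m => 1 / (m : ℝ) ^ (1 / (d : ℝ)))
        (fun m => (m : ℝ) ^ ((1.01 : ℝ) + 1 / (d : ℝ)))) ∧
    (∃ (L : ℕ → ℕ) (γ : ℕ → ℕ → ℝ),
      SpatialMatching.HGAchieves 1 L γ
        (fun m => (Real.log m) ^ 2 / (m : ℝ))
        (fun m => (m : ℝ) ^ 3)) :=
  ⟨fun _ hd => ⟨_, _, SpatialMatching.hgAchieves_of_two_le hd⟩,
    ⟨_, _, SpatialMatching.hgAchieves_one⟩⟩
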